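/- Throughout, $\log$ is the logarithm to base $2$ and $\rho(x)=\max(x,0)$, applied componentwise to vectors. A ReLU network $\Phi\colon\mathbb{R}\to\mathbb{R}$ of depth $\mathcal{L}(\Phi)=L\ge 1$ is given by layer dimensions $N_0=1,N_1,\dots,N_{L-1}\ge 1,N_L=1$ and affine maps $W_\ell(x)=A_\ell x+b_\ell$ with $A_\ell\in\mathbb{R}^{N_\ell\times N_{\ell-1}}$, $b_\ell\in\mathbb{R}^{N_\ell}$, $\ell=1,\dots,L$, and it realizes the map $\Phi=W_L\circ\rho\circ W_{L-1}\circ\rho\circ\dots\circ\rho\circ W_1$ ($\Phi=W_1$ if $L=1$). Its width $\mathcal{W}(\Phi)$ is $\max_{0\le\ell\le L}N_\ell$, and its weight magnitude $\mathcal{B}(\Phi)$ is the largest absolute value of an entry of any $A_\ell$ or $b_\ell$. Networks are non-degenerate: every node in layers $0,\dots,L-1$ has at least one outgoing edge of non-zero weight (every column of every $A_\ell$ is non-zero) and every output node has at least one incoming edge of non-zero weight (every row of $A_L$ is non-zero). For $D>0$ let $$\mathcal{S}_{[-D,D]}=\Big\{f\in C^\infty([-D,D],\mathbb{R})\colon \sup_{x\in[-D,D]}|f^{(n)}(x)|\le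 n!\ \text{ for all integers } n\ge 0\Big\},$$ and for $D,a>0$ let $\mathcal{F}_{D,a}=\{\cos(ag)\,h\colon g,h\in\mathcal{S}_{[-D,D]}\}$ (one-dimensional oscillatory textures). Proposition. There exists a constant $C>0$ such that for all $D,a>0$, all $f\in\mathcal{F}_{D,a}$, and all $\epsilon\in(0,1/2)$, there is a ReLU network $\Gamma_{f,\epsilon}\colon\mathbb{R}\to\mathbb{R}$ satisfying $$\sup_{x\in[-D,D]}|f(x)-\Gamma_{f,\epsilon}(x)|\le\epsilon,$$ $$\mathcal{L}(\Gamma_{f,\epsilon})\le C\lceil D\rceil\Big(\big(\log(\epsilon^{-1})+\log(\lceil a\rceil)\big)^2+\log(\lceil D\rceil)+\log(\lceil D^{-1}\rceil)\Big),$$ $\mathcal{W}(\Gamma_{f,\epsilon})\le 32$, and $\mathcal{B}(\Gamma_{f,\epsilon})\le 1$. -/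

import Mathlib

/-- The ReLU activation function. -/
noncomputable def relu (x : ℝ) : ℝ := max x 0

/-- A ReLU neural network with input dimension `d` and output dimension `d'`, given by its list of
affine transformations `x ↦ A x + b`: either a single affine transformation (depth one), or a first
affine transformation into a hidden layer of dimension `n`, which is followed by the
componentwise ReLU and by a network that starts from that layer. -/
inductive ReLUNetwork : ℕ → ℕ → Type
  | affine {d d' : ℕ} (A : Matrix (Fin d') (Fin d) ℝ) (b : Fin d' → ℝ) : ReLUNetwork d d'
  | layer {d n d' : ℕ} (A : Matrix (Fin n) (Fin d) ℝ) (b : Fin n → ℝ) (Φ : ReLUNetwork n d') :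
      ReLUNetwork d d'

namespace ReLUNetwork

/-- The map `W_L ∘ ρ ∘ W_{L-1} ∘ ρ ∘ ⋯ ∘ ρ ∘ W_1` realized by the network. -/
noncomputable def realize : {d d' : ℕ} → ReLUNetwork d d' → (Fin d → ℝ) → (Fin d' → ℝ)
  | _, _, affine A b, x => A.mulVec x + b
  | _, _, layer A b Φ, x => Φ.realize (fun i => relu ((A.mulVec x + b) i))

/-- Depth: the number of affine transformations. -/
def depth : {d d' : ℕ} → ReLUNetwork d d' → ℕ
  | _, _, affine _ _ => 1
  | _, _, layer _ _ Φ => Φ.depth + 1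

/-- Width: the maximum of all layer dimensions, input and output layers included. -/
def width : {d d' : ℕ} → ReLUNetwork d d' → ℕ
  | d, d', affine _ _ => max d d'
  | d, _, layer _ _ Φ => max d Φ.width

/-- The maximum of the absolute values of the entries of `A` and of `b`. -/
noncomputable def affineMagnitude {m n : ℕ} (A : Matrix (Fin m) (Fin n) ℝ) (b : Fin m → ℝ) :
    NNReal :=
  max (Finset.univ.sup fun i => Finset.univ.sup fun j => ‖A i j‖₊)
    (Finset.univ.sup fun i => ‖b i‖₊)

/-- Weight magnitude: the maximum absolute value of all edge weights and node weights. -/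
noncomputable def weightMagnitude : {d d' : ℕ} → ReLUNetwork d d' → NNReal
  | _, _, affine A b => affineMagnitude A b
  | _, _, layer A b Φ => max (affineMagnitude A b) Φ.weightMagnitude

/-- Non-degeneracy: every input node and every hidden node has an outgoing edge (a non-zero
weight in the next matrix), and every output node has an incoming edge. If `d > 0`,
this forces all hidden layers to have positive dimension. -/
def Nondegenerate : {d d' : ℕ} → ReLUNetwork d d' → Prop
  | _, _, affine A _ => (∀ j, ∃ i, A i j ≠ 0) ∧ (∀ i, ∃ j, A i j ≠ 0)
  | _, _, layer A _ Φ => (∀ j, ∃ i, A i j ≠ 0) ∧ Φ.Nondegenerate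

end ReLUNetwork

/-- The class of smooth functions on `[a, b]` (represented by functions on `ℝ` of which only the
values on `[a, b]` matter) whose `n`-th derivative is bounded by `n!` on `[a, b]`, for all `n ≥ 0`;
derivatives at the end points are one-sided. -/
def smoothClass (a b : ℝ) : Set (ℝ → ℝ) :=
  {f | ContDiffOn ℝ (⊤ : ℕ∞) f (Set.Icc a b) ∧
    ∀ n : ℕ, ∀ x ∈ Set.Icc a b,
      |iteratedDerivWithin n f (Set.Icc a b) x| ≤ (Nat.factorial n : ℝ)}

/-- The oscillatory textures `cos (a g) h` on `[-D, D]`, with `g` and `h` in the above class. -/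
def oscillatoryTextures (D a : ℝ) : Set (ℝ → ℝ) :=
  {f | ∃ g ∈ smoothClass (-D) D, ∃ h ∈ smoothClass (-D) D,
    ∀ x ∈ Set.Icc (-D) D, f x = Real.cos (a * g x) * h x}

/-! The interval is cut into pieces of length `1/4`. There `g` and `h` agree with their Taylor
polynomials at the left end point up to `2 ^ (-N)`, with coefficients of modulus at most `1`
(`exists_taylor_coeff`). Networks evaluate these by Horner's scheme with an approximate product:
polarization reduces products to squares, and `x - x ^ 2` is a rapidly convergent sum of scaled
iterated tent maps. The cosine of a large argument comes from `1 - θ ^ 2 / 2` at a tiny angle by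
iterating `cos 2θ = 2 cos² θ - 1`. Each doubling multiplies the error by about `4`, so
logarithmically many doublings of high-accuracy products suffice. This gives `exists_local_approx`,
with depth quadratic in `log (a / ε)`.

The pieces are glued one after another at bounded width (`Computes.exists_glued`). The network
carries the length still to be travelled and an accumulator, to which each piece adds its increment
plus a small linear correction. The correction makes the accumulator equal `f / 2` exactly at the
grid points, so errors do not add up over the pieces.

Non-degeneracy is ignored until the end: replacing zero weights by a small `τ` changes the
realization uniformly little on a compact set (`ReLUNetwork.exists_nondegenerate_near`). -/

theorem relu_nonneg (x : ℝ) : 0 ≤ relu x := le_max_right _ _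

theorem relu_of_nonneg {x : ℝ} (h : 0 ≤ x) : relu x = x := max_eq_left h

theorem relu_of_nonpos {x : ℝ} (h : x ≤ 0) : relu x = 0 := max_eq_right h

@[simp] theorem relu_relu (x : ℝ) : relu (relu x) = relu x := relu_of_nonneg (relu_nonneg x)

theorem relu_sub_relu_neg (x : ℝ) : relu x - relu (-x) = x := by
  rcases le_total 0 x with h | h
  · rw [relu_of_nonneg h, relu_of_nonpos (by linarith)]; ring
  · rw [relu_of_nonpos h, relu_of_nonneg (by linarith)]; ring

theorem relu_add_relu_neg (x : ℝ) : relu x + relu (-x) = |x| := by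
  rcases le_total 0 x with h | h
  · rw [relu_of_nonneg h, relu_of_nonpos (by linarith), abs_of_nonneg h]; ring
  · rw [relu_of_nonpos h, relu_of_nonneg (by linarith), abs_of_nonpos h]; ring

theorem continuous_relu : Continuous relu := continuous_id.max continuous_const

/-! ### Appending layers and removing zero weights -/

namespace ReLUNetwork

theorem affineMagnitude_le_one_iff {m n : ℕ} (A : Matrix (Fin m) (Fin n) ℝ) (b : Fin m → ℝ) :
    affineMagnitude A b ≤ 1 ↔ (∀ i j, |A i j| ≤ 1) ∧ ∀ i, |b i| ≤ 1 := by
  simp only [affineMagnitude, max_le_iff, Finset.sup_le_iff, Finset.mem_univ, true_imp_iff,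
    ← NNReal.coe_le_coe, coe_nnnorm, Real.norm_eq_abs, NNReal.coe_one]

/-- Appends a ReLU layer and an affine map at the output end of a network. -/
def snoc : {d n d' : ℕ} → ReLUNetwork d n → Matrix (Fin d') (Fin n) ℝ → (Fin d' → ℝ) →
    ReLUNetwork d d'
  | _, _, _, affine A₀ b₀, A, b => layer A₀ b₀ (affine A b)
  | _, _, _, layer A₀ b₀ Φ, A, b => layer A₀ b₀ (Φ.snoc A b)

/-- Every hidden layer and the output layer have at least one node. -/
def PosDims : {d d' : ℕ} → ReLUNetwork d d' → Prop
  | _, d', affine _ _ => 0 < d'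
  | _, _, @layer _ n _ _ _ Φ => 0 < n ∧ Φ.PosDims

section snoc

variable {d n d' : ℕ}

theorem realize_snoc (Φ : ReLUNetwork d n) (A : Matrix (Fin d') (Fin n) ℝ) (b : Fin d' → ℝ)
    (x : Fin d → ℝ) :
    (Φ.snoc A b).realize x = A.mulVec (fun i => relu (Φ.realize x i)) + b := by
  induction Φ with
  | affine => rfl
  | layer _ _ _ ih => exact ih _ _

theorem depth_snoc (Φ : ReLUNetwork d n) (A : Matrix (Fin d') (Fin n) ℝ) (b : Fin d' → ℝ) :
    (Φ.snoc A b).depth = Φ.depth + 1 := by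
  induction Φ with
  | affine => rfl
  | layer _ _ _ ih => simp only [snoc, depth, ih]

theorem width_snoc (Φ : ReLUNetwork d n) (A : Matrix (Fin d') (Fin n) ℝ) (b : Fin d' → ℝ) :
    (Φ.snoc A b).width = max Φ.width d' := by
  induction Φ with
  | affine => simp only [snoc, width, max_assoc]
  | layer _ _ _ ih => simp only [snoc, width, ih, max_assoc]

theorem weightMagnitude_snoc (Φ : ReLUNetwork d n) (A : Matrix (Fin d') (Fin n) ℝ)
    (b : Fin d' → ℝ) :
    (Φ.snoc A b).weightMagnitude = max Φ.weightMagnitude (affineMagnitude A b) := by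
  induction Φ with
  | affine => rfl
  | layer _ _ _ ih => simp only [snoc, weightMagnitude, ih, max_assoc]

theorem PosDims.snoc {Φ : ReLUNetwork d n} (h : Φ.PosDims) (hd : 0 < d')
    (A : Matrix (Fin d') (Fin n) ℝ) (b : Fin d' → ℝ) : (Φ.snoc A b).PosDims := by
  induction Φ with
  | affine => exact ⟨h, hd⟩
  | layer _ _ _ ih => exact ⟨h.1, ih h.2 _⟩

end snoc

/-- Replaces the vanishing entries of a matrix by `τ`. -/
noncomputable def fillZeros {m n : ℕ} (τ : ℝ) (A : Matrix (Fin m) (Fin n) ℝ) :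
    Matrix (Fin m) (Fin n) ℝ :=
  Matrix.of fun i j => A i j + if A i j = 0 then τ else 0

/-- Replaces all vanishing edge weights by `τ`. -/
noncomputable def perturb (τ : ℝ) : {d d' : ℕ} → ReLUNetwork d d' → ReLUNetwork d d'
  | _, _, affine A b => affine (fillZeros τ A) b
  | _, _, layer A b Φ => layer (fillZeros τ A) b (Φ.perturb τ)

theorem fillZeros_ne_zero {m n : ℕ} {τ : ℝ} (hτ : τ ≠ 0) (A : Matrix (Fin m) (Fin n) ℝ)
    (i : Fin m) (j : Fin n) : fillZeros τ A i j ≠ 0 := by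
  by_cases h : A i j = 0 <;> simp [fillZeros, h, hτ]

theorem fillZeros_zero {m n : ℕ} (A : Matrix (Fin m) (Fin n) ℝ) : fillZeros 0 A = A := by
  ext i j; simp [fillZeros]

theorem affineMagnitude_fillZeros_le {m n : ℕ} {τ : ℝ} (h0 : 0 ≤ τ) (h1 : τ ≤ 1)
    {A : Matrix (Fin m) (Fin n) ℝ} {b : Fin m → ℝ} (h : affineMagnitude A b ≤ 1) :
    affineMagnitude (fillZeros τ A) b ≤ 1 := by
  rw [affineMagnitude_le_one_iff] at h ⊢
  refine ⟨fun i j => ?_, h.2⟩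
  by_cases hA : A i j = 0
  · simp [fillZeros, hA, abs_of_nonneg h0, h1]
  · simpa [fillZeros, hA] using h.1 i j

variable {d d' : ℕ}

theorem perturb_zero (Φ : ReLUNetwork d d') : Φ.perturb 0 = Φ := by
  induction Φ with
  | affine => simp only [perturb, fillZeros_zero]
  | layer _ _ _ ih => simp only [perturb, fillZeros_zero, ih]

theorem depth_perturb (τ : ℝ) (Φ : ReLUNetwork d d') : (Φ.perturb τ).depth = Φ.depth := by
  induction Φ with
  | affine => rfl
  | layer _ _ _ ih => simp only [perturb, depth, ih]

theorem width_perturb (τ : ℝ) (Φ : ReLUNetwork d d') : (Φ.perturb τ).width = Φ.width := by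
  induction Φ with
  | affine => rfl
  | layer _ _ _ ih => simp only [perturb, width, ih]

theorem weightMagnitude_perturb_le {τ : ℝ} (h0 : 0 ≤ τ) (h1 : τ ≤ 1) {Φ : ReLUNetwork d d'}
    (h : Φ.weightMagnitude ≤ 1) : (Φ.perturb τ).weightMagnitude ≤ 1 := by
  induction Φ with
  | affine => exact affineMagnitude_fillZeros_le h0 h1 h
  | layer _ _ _ ih =>
    have h' := max_le_iff.1 h
    exact max_le (affineMagnitude_fillZeros_le h0 h1 h'.1) (ih h'.2)

theorem nondegenerate_perturb {τ : ℝ} (hτ : τ ≠ 0) {Φ : ReLUNetwork d d'} (hd : 0 < d)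
    (h : Φ.PosDims) : (Φ.perturb τ).Nondegenerate := by
  induction Φ with
  | affine A b =>
    exact ⟨fun j => ⟨⟨0, h⟩, fillZeros_ne_zero hτ _ _ _⟩,
      fun i => ⟨⟨0, hd⟩, fillZeros_ne_zero hτ _ _ _⟩⟩
  | layer A b Φ ih =>
    exact ⟨fun j => ⟨⟨0, h.1⟩, fillZeros_ne_zero hτ _ _ _⟩, ih h.1 h.2⟩

/-- Which entries get filled depends on `A` only, so every entry is affine in `τ`. -/
theorem continuous_fillZeros {m n : ℕ} (A : Matrix (Fin m) (Fin n) ℝ) :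
    Continuous fun τ : ℝ => fillZeros τ A := by
  refine continuous_matrix fun i j => ?_
  by_cases h : A i j = 0 <;> simp only [fillZeros, Matrix.of_apply, h, if_true, if_false] <;>
    fun_prop

theorem continuous_realize_perturb (Φ : ReLUNetwork d d') :
    Continuous fun p : ℝ × (Fin d → ℝ) => (Φ.perturb p.1).realize p.2 := by
  induction Φ with
  | affine A b =>
    exact (((continuous_fillZeros A).comp continuous_fst).matrix_mulVec continuous_snd).add
      continuous_const
  | layer A b Φ ih =>
    have h : Continuous fun p : ℝ × (Fin _ → ℝ) => (fillZeros p.1 A).mulVec p.2 + b :=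
      (((continuous_fillZeros A).comp continuous_fst).matrix_mulVec continuous_snd).add
        continuous_const
    refine ih.comp (continuous_fst.prodMk (continuous_pi fun i => ?_))
    exact continuous_relu.comp ((continuous_apply i).comp h)

/-- On a compact set, a network is approximated by a non-degenerate one of the same shape. -/
theorem exists_nondegenerate_near {Φ : ReLUNetwork d d'} (hd : 0 < d) (hΦ : Φ.PosDims)
    (hw : Φ.weightMagnitude ≤ 1) {K : Set (Fin d → ℝ)} (hK : IsCompact K) {δ : ℝ} (hδ : 0 < δ) :
    ∃ Ψ : ReLUNetwork d d', Ψ.Nondegenerate ∧ Ψ.depth = Φ.depth ∧ Ψ.width = Φ.width ∧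
      Ψ.weightMagnitude ≤ 1 ∧ ∀ x ∈ K, dist (Φ.realize x) (Ψ.realize x) ≤ δ := by
  have huc := ((isCompact_Icc (a := (0 : ℝ)) (b := 1)).prod hK).uniformContinuousOn_of_continuous
    (continuous_realize_perturb Φ).continuousOn
  obtain ⟨η, hη, h⟩ := Metric.uniformContinuousOn_iff.1 huc δ hδ
  -- The filled-in weight `min (η / 2) 1` is within the modulus of continuity and respects the
  -- weight bound.
  have hm : 0 < min (η / 2) 1 := lt_min (by linarith) one_pos
  refine ⟨Φ.perturb (min (η / 2) 1), nondegenerate_perturb hm.ne' hd hΦ, depth_perturb _ _,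
    width_perturb _ _, weightMagnitude_perturb_le hm.le (min_le_right _ _) hw, fun x hx => ?_⟩
  have := h (0, x) ⟨⟨le_rfl, zero_le_one⟩, hx⟩ (min (η / 2) 1, x)
    ⟨⟨hm.le, min_le_right _ _⟩, hx⟩ (by
      rw [Prod.dist_eq, dist_self, max_eq_left dist_nonneg, Real.dist_eq, zero_sub, abs_neg,
        abs_of_pos hm]
      linarith [min_le_left (η / 2) 1])
  simpa only [perturb_zero] using this.le

end ReLUNetwork

/-! ### Building networks layer by layer from lists of node functions -/

/-- `∑ i, ws i * relu (l i x)`, where the shorter of the two lists is padded by zeros. -/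
noncomputable def reluCombination : List ℝ → List (ℝ → ℝ) → ℝ → ℝ
  | w :: ws, f :: l, x => w * relu (f x) + reluCombination ws l x
  | [], _, _ => 0
  | _ :: _, [], _ => 0

@[simp] theorem reluCombination_cons (w : ℝ) (ws : List ℝ) (f : ℝ → ℝ) (l : List (ℝ → ℝ)) (x : ℝ) :
    reluCombination (w :: ws) (f :: l) x = w * relu (f x) + reluCombination ws l x := rfl

@[simp] theorem reluCombination_nil (l : List (ℝ → ℝ)) (x : ℝ) :
    reluCombination [] l x = 0 := by
  simp [reluCombination]

theorem reluCombination_eq_sum (ws : List ℝ) (l : List (ℝ → ℝ)) (x : ℝ) :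
    reluCombination ws l x = ∑ i : Fin l.length, ws.getD i 0 * relu (l.get i x) := by
  induction l generalizing ws with
  | nil => cases ws <;> simp [reluCombination]
  | cons f l ih =>
    cases ws with
    | nil => simp
    | cons w ws =>
      rw [reluCombination_cons, ih]
      exact (Fin.sum_univ_succ (n := l.length)
        (fun i => (w :: ws).getD i 0 * relu ((f :: l).get i x))).symm

/-- On `X`, the function `g` is an affine combination of the rectified functions in `l`,
with coefficients of absolute value at most `1`. -/
def IsReadout (X : Set ℝ) (l : List (ℝ → ℝ)) (g : ℝ → ℝ) : Prop :=
  ∃ (ws : List ℝ) (b : ℝ), (∀ w ∈ ws, |w| ≤ 1) ∧ |b| ≤ 1 ∧ ∀ x ∈ X, g x = reluCombination ws l x + b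

theorem IsReadout.cons {X : Set ℝ} {l : List (ℝ → ℝ)} {g : ℝ → ℝ} (h : IsReadout X l g)
    (f : ℝ → ℝ) : IsReadout X (f :: l) g := by
  obtain ⟨ws, b, hw, hb, h⟩ := h
  exact ⟨0 :: ws, b, by simpa using hw, hb, fun x hx => by simpa using h x hx⟩

theorem IsReadout.append {X : Set ℝ} {l : List (ℝ → ℝ)} {g : ℝ → ℝ} (h : IsReadout X l g)
    (P : List (ℝ → ℝ)) : IsReadout X (P ++ l) g := by
  induction P with
  | nil => exact h
  | cons f P ih => exact ih.cons f

theorem IsReadout.of_mem {X : Set ℝ} {l : List (ℝ → ℝ)} {g : ℝ → ℝ} (hg : g ∈ l)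
    (h : ∀ x ∈ X, 0 ≤ g x) : IsReadout X l g := by
  induction l with
  | nil => simp at hg
  | cons f l ih =>
    rcases List.mem_cons.1 hg with rfl | hg
    · exact ⟨[1], 0, by simp, by simp, fun x hx => by simp [relu_of_nonneg (h x hx)]⟩
    · exact (ih hg).cons f

/-- The functions in `l` are, on `X`, the outputs of a network of depth at most `L`, width at most
`32` and weight magnitude at most `1`. -/
def Computes (X : Set ℝ) (L : ℕ) (l : List (ℝ → ℝ)) : Prop :=
  ∃ Φ : ReLUNetwork 1 l.length, Φ.PosDims ∧ Φ.depth ≤ L ∧ Φ.width ≤ 32 ∧ Φ.weightMagnitude ≤ 1 ∧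
    ∀ x ∈ X, ∀ i, Φ.realize (fun _ => x) i = l.get i x

namespace Computes

variable {X : Set ℝ} {L : ℕ}

theorem mono {l : List (ℝ → ℝ)} (h : Computes X L l) {L' : ℕ} (hL : L ≤ L') : Computes X L' l := by
  obtain ⟨Φ, h1, h2, h3⟩ := h
  exact ⟨Φ, h1, h2.trans hL, h3⟩

theorem id_neg : Computes X 1 [fun x => x, fun x => -x] := by
  refine ⟨.affine (Matrix.of ![![1], ![-1]]) 0, by simp [ReLUNetwork.PosDims], le_rfl,
    by simp [ReLUNetwork.width], ?_, ?_⟩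
  · refine (ReLUNetwork.affineMagnitude_le_one_iff _ _).2 ⟨fun i j => ?_, by simp⟩
    fin_cases i <;> fin_cases j <;> simp
  · intro x _ i
    fin_cases i <;> simp [ReLUNetwork.realize, dotProduct]

/-- One more layer. -/
theorem step {l l' : List (ℝ → ℝ)} (h : Computes X L l) (hne : 0 < l'.length)
    (hlen : l'.length ≤ 32) (hl : ∀ g ∈ l', IsReadout X l g) : Computes X (L + 1) l' := by
  obtain ⟨Φ, hpos, hdepth, hwidth, hmag, hΦ⟩ := h
  choose ws b hw hb hg using fun i : Fin l'.length => hl _ (l'.get_mem i)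
  refine ⟨Φ.snoc (Matrix.of fun i j => (ws i).getD j 0) b, hpos.snoc hne _ _, ?_, ?_, ?_, ?_⟩
  · rw [ReLUNetwork.depth_snoc]; omega
  · rw [ReLUNetwork.width_snoc]; exact max_le hwidth hlen
  · rw [ReLUNetwork.weightMagnitude_snoc]
    refine max_le hmag ((ReLUNetwork.affineMagnitude_le_one_iff _ _).2 ⟨fun i j => ?_, hb⟩)
    simp only [Matrix.of_apply, List.getD_eq_getElem?_getD]
    rcases lt_or_ge (j : ℕ) (ws i).length with hj | hj
    · simpa [hj] using hw i _ (List.getElem_mem hj)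
    · simp [hj]
  · intro x hx i
    rw [ReLUNetwork.realize_snoc, hg i x hx, reluCombination_eq_sum]
    simp only [Pi.add_apply, Matrix.mulVec, dotProduct, Matrix.of_apply, hΦ x hx]

/-- One more layer, which leaves a list `F` of non-negative functions unchanged. -/
theorem frame_step {P Q F : List (ℝ → ℝ)} (h : Computes X L (P ++ F)) (hQ : 0 < Q.length)
    (hlen : Q.length + F.length ≤ 32) (hF : ∀ g ∈ F, ∀ x ∈ X, 0 ≤ g x)
    (hl : ∀ g ∈ Q, IsReadout X (P ++ F) g) : Computes X (L + 1) (Q ++ F) := by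
  refine h.step (by simp; omega) (by simpa using hlen) fun g hg => ?_
  rcases List.mem_append.1 hg with hg | hg
  · exact hl g hg
  · exact (IsReadout.of_mem hg (hF g hg)).append P

end Computes

/-! ### Squares and products from tent maps -/

/-- The scaled iterated tent map: `4 ^ s * tentIter s t` is the `s`-th iterate of the tent map
at `t`, for `t` in `[0, 1]`. -/
noncomputable def tentIter : ℕ → ℝ → ℝ
  | 0, t => t
  | s + 1, t => tentIter s t / 2 - relu (tentIter s t - (1 / 4) ^ s / 2)

/-- The piecewise linear interpolation of the square function at the multiples of `2 ^ (-s)`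
in `[0, 1]`. -/
noncomputable def sqInterp : ℕ → ℝ → ℝ
  | 0, t => t
  | s + 1, t => sqInterp s t - tentIter (s + 1) t

theorem tentIter_mem {t : ℝ} (ht : t ∈ Set.Icc (0 : ℝ) 1) (s : ℕ) :
    tentIter s t ∈ Set.Icc (0 : ℝ) ((1 / 4) ^ s) := by
  induction s with
  | zero => simpa [tentIter] using ht
  | succ s ih =>
    obtain ⟨h0, h1⟩ := ih
    rw [tentIter, pow_succ]
    rcases le_total (tentIter s t) ((1 / 4) ^ s / 2) with h | h
    · rw [relu_of_nonpos (by linarith)]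
      constructor <;> linarith
    · rw [relu_of_nonneg (by linarith)]
      constructor <;> linarith

/-- With `y = 4 ^ s * tentIter s t` the right side is `4 ^ (-s) * y * (1 - y)`. One step subtracts a
quarter of the tent map of `y`, at the same scale, on either branch of the tent. -/
theorem sqInterp_sub_sq (t : ℝ) (s : ℕ) :
    sqInterp s t - t ^ 2 = tentIter s t - 4 ^ s * tentIter s t ^ 2 := by
  induction s with
  | zero => simp [sqInterp, tentIter]
  | succ s ih =>
    have hp : (4 : ℝ) ^ s * (1 / 4) ^ s = 1 := by rw [← mul_pow]; norm_num
    rw [sqInterp, tentIter, pow_succ]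
    rcases le_total (tentIter s t) ((1 / 4) ^ s / 2) with h | h
    · rw [relu_of_nonpos (by linarith)]
      linear_combination ih
    · rw [relu_of_nonneg (by linarith)]
      linear_combination ih + (-2 * tentIter s t + (1 / 4) ^ s) * hp

theorem sq_le_sqInterp {t : ℝ} (ht : t ∈ Set.Icc (0 : ℝ) 1) (s : ℕ) : t ^ 2 ≤ sqInterp s t := by
  have h := sqInterp_sub_sq t s
  obtain ⟨h0, h1⟩ := tentIter_mem ht s
  have hp : (4 : ℝ) ^ s * (1 / 4) ^ s = 1 := by rw [← mul_pow]; norm_num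
  have : 4 ^ s * tentIter s t ≤ 1 := by
    rw [← hp]; gcongr
  nlinarith

theorem sqInterp_le {t : ℝ} (ht : t ∈ Set.Icc (0 : ℝ) 1) (s : ℕ) :
    sqInterp s t ≤ t ^ 2 + (1 / 4) ^ s := by
  have h := sqInterp_sub_sq t s
  obtain ⟨h0, h1⟩ := tentIter_mem ht s
  have : 0 ≤ (4 : ℝ) ^ s * tentIter s t ^ 2 := by positivity
  linarith

theorem sqInterp_le_one {t : ℝ} (ht : t ∈ Set.Icc (0 : ℝ) 1) (s : ℕ) : sqInterp s t ≤ 1 := by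
  induction s with
  | zero => exact ht.2
  | succ s ih => rw [sqInterp]; linarith [(tentIter_mem ht (s + 1)).1]

theorem sqInterp_zero (s : ℕ) : sqInterp s 0 = 0 :=
  le_antisymm (by
    have h := sqInterp_sub_sq 0 s
    have : tentIter s 0 = 0 := by
      clear h
      induction s with
      | zero => rfl
      | succ s ih => rw [tentIter, ih, relu_of_nonpos (by rw [zero_sub]; exact neg_nonpos.2 (by positivity))]; simp
    simp [this] at h
    exact h.le) (by simpa using sq_le_sqInterp (t := 0) (by simp) s)

/-- The approximate product realized by networks. -/
noncomputable def approxMul (M : ℕ) (u v : ℝ) : ℝ :=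
  sqInterp M |(u + v) / 2| - sqInterp M |(u - v) / 2|

theorem abs_half_mem {u v : ℝ} (h : |u| + |v| ≤ 2) :
    |(u + v) / 2| ∈ Set.Icc (0 : ℝ) 1 ∧ |(u - v) / 2| ∈ Set.Icc (0 : ℝ) 1 := by
  have h1 := abs_add_le u v
  have h2 := abs_sub u v
  refine ⟨⟨abs_nonneg _, ?_⟩, abs_nonneg _, ?_⟩ <;> rw [abs_div, abs_two] <;> linarith

/-- Polarization: `u v = ((u + v) / 2) ^ 2 - ((u - v) / 2) ^ 2`. Both squares are overestimated by
at most `4 ^ (-M)`, so the difference is off by no more than that. -/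
theorem abs_approxMul_sub_le {u v : ℝ} (h : |u| + |v| ≤ 2) (M : ℕ) :
    |approxMul M u v - u * v| ≤ (1 / 4) ^ M := by
  obtain ⟨h1, h2⟩ := abs_half_mem h
  have a1 := sq_le_sqInterp h1 M
  have a2 := sqInterp_le h1 M
  have a3 := sq_le_sqInterp h2 M
  have a4 := sqInterp_le h2 M
  simp only [sq_abs] at a1 a2 a3 a4
  rw [approxMul, abs_le]
  constructor <;> nlinarith

/-- Approximate squares stay exactly in `[0, 1]`, which keeps the iterated doubling of the cosine
inside `[-1, 1]`. -/
theorem approxMul_self_mem {u : ℝ} (h : |u| ≤ 1) (M : ℕ) :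
    approxMul M u u ∈ Set.Icc (0 : ℝ) 1 := by
  have h1 := (abs_half_mem (u := u) (v := u) (by linarith)).1
  rw [approxMul, sub_self, zero_div, abs_zero, sqInterp_zero, sub_zero]
  exact ⟨(sq_nonneg _).trans (sq_le_sqInterp h1 M), sqInterp_le_one h1 M⟩

/-! ### Networks for products -/

namespace Computes

variable {X : Set ℝ} {L : ℕ} {F : List (ℝ → ℝ)}

/-- Two squarings run in parallel. The third and sixth nodes hold the argument of the rectifier in
the tent map, which the next layer applies. The scaling by `4 ^ (-s)` keeps all weights in `[-1,
1]`. -/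
theorem sqInterp_pair {s t : ℝ → ℝ} (hs : ∀ x ∈ X, s x ∈ Set.Icc (0 : ℝ) 1)
    (ht : ∀ x ∈ X, t x ∈ Set.Icc (0 : ℝ) 1) (hF : ∀ g ∈ F, ∀ x ∈ X, 0 ≤ g x)
    (hlen : F.length ≤ 26) (M : ℕ)
    (h : Computes X L ([s, s, fun x => s x - 1 / 2, t, t, fun x => t x - 1 / 2] ++ F)) :
    Computes X (L + M) ([fun x => sqInterp M (s x), fun x => tentIter M (s x),
      fun x => tentIter M (s x) - (1 / 4) ^ M / 2, fun x => sqInterp M (t x),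
      fun x => tentIter M (t x), fun x => tentIter M (t x) - (1 / 4) ^ M / 2] ++ F) := by
  induction M with
  | zero => simpa [sqInterp, tentIter] using h
  | succ M ih =>
    refine ih.frame_step (by simp) (by simp; omega) hF ?_
    have hb : |-((1 / 4 : ℝ) ^ (M + 1) / 2)| ≤ 1 := by
      have : (1 / 4 : ℝ) ^ (M + 1) ≤ 1 := pow_le_one₀ (by norm_num) (by norm_num)
      rw [abs_neg, abs_of_nonneg (by positivity)]; linarith
    have h2 : (2⁻¹ : ℝ) ≤ 1 := by norm_num
    have hS : ∀ x ∈ X, relu (sqInterp M (s x)) = sqInterp M (s x) := fun x hx =>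
      relu_of_nonneg ((sq_nonneg _).trans (sq_le_sqInterp (hs x hx) M))
    have hT : ∀ x ∈ X, relu (sqInterp M (t x)) = sqInterp M (t x) := fun x hx =>
      relu_of_nonneg ((sq_nonneg _).trans (sq_le_sqInterp (ht x hx) M))
    have hS' : ∀ x ∈ X, relu (tentIter M (s x)) = tentIter M (s x) := fun x hx =>
      relu_of_nonneg (tentIter_mem (hs x hx) M).1
    have hT' : ∀ x ∈ X, relu (tentIter M (t x)) = tentIter M (t x) := fun x hx =>
      relu_of_nonneg (tentIter_mem (ht x hx) M).1
    simp only [List.mem_cons, List.not_mem_nil, or_false, forall_eq_or_imp, forall_eq]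
    refine ⟨⟨[1, -2⁻¹, 1], 0, by simp [h2], by simp, fun x hx => ?_⟩,
      ⟨[0, 2⁻¹, -1], 0, by simp [h2], by simp, fun x hx => ?_⟩,
      ⟨[0, 2⁻¹, -1], -((1 / 4) ^ (M + 1) / 2), by simp [h2], hb, fun x hx => ?_⟩,
      ⟨[0, 0, 0, 1, -2⁻¹, 1], 0, by simp [h2], by simp, fun x hx => ?_⟩,
      ⟨[0, 0, 0, 0, 2⁻¹, -1], 0, by simp [h2], by simp, fun x hx => ?_⟩,
      ⟨[0, 0, 0, 0, 2⁻¹, -1], -((1 / 4) ^ (M + 1) / 2), by simp [h2], hb, fun x hx => ?_⟩⟩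
    all_goals
      simp only [List.cons_append, reluCombination_cons, reluCombination_nil, hS x hx, hT x hx,
        hS' x hx, hT' x hx, sqInterp, tentIter]
      ring

/-- Signed functions are passed on with both signs, since `u = relu u - relu (-u)`. The output comes
twice so that a later layer can multiply it by `2` with weights of modulus `1`. -/
theorem approxMul {u v : ℝ → ℝ} (huv : ∀ x ∈ X, |u x| + |v x| ≤ 2)
    (hF : ∀ g ∈ F, ∀ x ∈ X, 0 ≤ g x) (hlen : F.length ≤ 26) (M : ℕ)
    (h : Computes X L ([u, fun x => -u x, v, fun x => -v x] ++ F)) :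
    Computes X (L + (M + 3)) ([fun x => approxMul M (u x) (v x),
      fun x => -approxMul M (u x) (v x), fun x => approxMul M (u x) (v x),
      fun x => -approxMul M (u x) (v x)] ++ F) := by
  have h2 : (2⁻¹ : ℝ) ≤ 1 := by norm_num
  have s1 : Computes X (L + 1) ([fun x => (u x + v x) / 2, fun x => -((u x + v x) / 2),
      fun x => (u x - v x) / 2, fun x => -((u x - v x) / 2)] ++ F) := by
    refine h.frame_step (by simp) (by simp; omega) hF ?_
    simp only [List.mem_cons, List.not_mem_nil, or_false, forall_eq_or_imp, forall_eq]
    refine ⟨⟨[2⁻¹, -2⁻¹, 2⁻¹, -2⁻¹], 0, by simp [h2], by simp, fun x hx => ?_⟩,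
      ⟨[-2⁻¹, 2⁻¹, -2⁻¹, 2⁻¹], 0, by simp [h2], by simp, fun x hx => ?_⟩,
      ⟨[2⁻¹, -2⁻¹, -2⁻¹, 2⁻¹], 0, by simp [h2], by simp, fun x hx => ?_⟩,
      ⟨[-2⁻¹, 2⁻¹, 2⁻¹, -2⁻¹], 0, by simp [h2], by simp, fun x hx => ?_⟩⟩
    all_goals
      simp only [List.cons_append, reluCombination_cons, reluCombination_nil]
      rw [← sub_eq_zero]
      nth_rw 1 [← relu_sub_relu_neg (u x), ← relu_sub_relu_neg (v x)]
      ring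
  have s2 : Computes X (L + 1 + 1) ([fun x => |(u x + v x) / 2|, fun x => |(u x + v x) / 2|,
      fun x => |(u x + v x) / 2| - 1 / 2, fun x => |(u x - v x) / 2|, fun x => |(u x - v x) / 2|,
      fun x => |(u x - v x) / 2| - 1 / 2] ++ F) := by
    refine s1.frame_step (by simp) (by simp; omega) hF ?_
    simp only [List.mem_cons, List.not_mem_nil, or_false, forall_eq_or_imp, forall_eq]
    refine ⟨⟨[1, 1], 0, by simp, by simp, fun x hx => ?_⟩,
      ⟨[1, 1], 0, by simp, by simp, fun x hx => ?_⟩,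
      ⟨[1, 1], -2⁻¹, by simp, by simp [h2], fun x hx => ?_⟩,
      ⟨[0, 0, 1, 1], 0, by simp, by simp, fun x hx => ?_⟩,
      ⟨[0, 0, 1, 1], 0, by simp, by simp, fun x hx => ?_⟩,
      ⟨[0, 0, 1, 1], -2⁻¹, by simp, by simp [h2], fun x hx => ?_⟩⟩
    all_goals
      simp only [List.cons_append, reluCombination_cons, reluCombination_nil, ← relu_add_relu_neg]
      ring
  have hu := fun x hx => (abs_half_mem (huv x hx)).1
  have hv := fun x hx => (abs_half_mem (huv x hx)).2
  have s3 := s2.sqInterp_pair hu hv hF hlen M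
  have s4 := s3.frame_step (Q := [fun x => _root_.approxMul M (u x) (v x),
      fun x => -_root_.approxMul M (u x) (v x), fun x => _root_.approxMul M (u x) (v x),
      fun x => -_root_.approxMul M (u x) (v x)]) (by simp) (by simp; omega) hF (by
    simp only [List.mem_cons, List.not_mem_nil, or_false, forall_eq_or_imp, forall_eq]
    refine ⟨⟨[1, 0, 0, -1], 0, by simp, by simp, fun x hx => ?_⟩,
      ⟨[-1, 0, 0, 1], 0, by simp, by simp, fun x hx => ?_⟩,
      ⟨[1, 0, 0, -1], 0, by simp, by simp, fun x hx => ?_⟩,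
      ⟨[-1, 0, 0, 1], 0, by simp, by simp, fun x hx => ?_⟩⟩
    all_goals
      simp only [List.cons_append, reluCombination_cons, reluCombination_nil, _root_.approxMul]
      rw [relu_of_nonneg ((sq_nonneg _).trans (sq_le_sqInterp (hu x hx) M)),
        relu_of_nonneg ((sq_nonneg _).trans (sq_le_sqInterp (hv x hx) M))]
      ring)
  exact s4.mono (by omega)

end Computes

/-! ### Polynomials and cosines: accuracy -/

/-- Horner evaluation of `∑ n < N, c n * z ^ n` by means of the approximate product. -/
noncomputable def approxHorner (M : ℕ) : ℕ → (ℕ → ℝ) → ℝ → ℝ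
  | 0, _, _ => 0
  | N + 1, c, z => c 0 + approxMul M z (approxHorner M N (fun n => c (n + 1)) z)

theorem quarter_pow_le {M : ℕ} (hM : 2 ≤ M) : (1 / 4 : ℝ) ^ M ≤ 1 / 16 :=
  (pow_le_pow_of_le_one (by norm_num) (by norm_num) hM).trans (by norm_num)

/-- The bound reproduces itself: `1 + (1 / 4) * (3 / 2) + 1 / 16 ≤ 3 / 2`. -/
theorem abs_approxHorner_le {M : ℕ} (hM : 2 ≤ M) {z : ℝ} (hz : z ∈ Set.Icc (0 : ℝ) (1 / 4)) (N : ℕ)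
    {c : ℕ → ℝ} (hc : ∀ n, |c n| ≤ 1) : |approxHorner M N c z| ≤ 3 / 2 := by
  induction N generalizing c with
  | zero => norm_num [approxHorner]
  | succ N ih =>
    have h := ih fun n => hc (n + 1)
    set p := approxHorner M N (fun n => c (n + 1)) z with hp
    have hz' : |z| = z := abs_of_nonneg hz.1
    have h1 := abs_approxMul_sub_le (u := z) (v := p) (by linarith [hz.2]) M
    have h2 := quarter_pow_le hM
    have h3 : |z * p| ≤ 1 / 4 * (3 / 2) := by
      rw [abs_mul, hz']; exact mul_le_mul hz.2 h (abs_nonneg _) (by norm_num)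
    rw [approxHorner, ← hp]
    have h4 := hc 0
    rw [abs_le] at *
    constructor <;> linarith [h1.1, h1.2, h3.1, h3.2, h4.1, h4.2]

/-- Multiplication by `z ≤ 1 / 4` contracts earlier errors, so they sum geometrically and the bound
is uniform in `N`. -/
theorem abs_approxHorner_sub_le {M : ℕ} (hM : 2 ≤ M) {z : ℝ} (hz : z ∈ Set.Icc (0 : ℝ) (1 / 4))
    (N : ℕ) {c : ℕ → ℝ} (hc : ∀ n, |c n| ≤ 1) :
    |approxHorner M N c z - ∑ n ∈ Finset.range N, c n * z ^ n| ≤ 2 * (1 / 4) ^ M := by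
  induction N generalizing c with
  | zero => simp [approxHorner]
  | succ N ih =>
    have h := ih fun n => hc (n + 1)
    have hb := abs_approxHorner_le hM hz N fun n => hc (n + 1)
    rw [approxHorner, Finset.sum_range_succ']
    set p := approxHorner M N (fun n => c (n + 1)) z
    set P := ∑ n ∈ Finset.range N, c (n + 1) * z ^ n with hP
    have hz' : |z| = z := abs_of_nonneg hz.1
    have h1 := abs_approxMul_sub_le (u := z) (v := p) (by linarith [hz.2]) M
    have h3 : |z * (p - P)| ≤ 1 / 4 * (2 * (1 / 4) ^ M) := by
      rw [abs_mul, hz']; exact mul_le_mul hz.2 h (abs_nonneg _) (by norm_num)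
    have h4 : ∑ n ∈ Finset.range N, c (n + 1) * z ^ (n + 1) = z * P := by
      rw [hP, Finset.mul_sum]; exact Finset.sum_congr rfl fun n _ => by ring
    rw [h4, show c 0 + approxMul M z p - (z * P + c 0 * z ^ 0) =
      (approxMul M z p - z * p) + z * (p - P) by ring]
    refine (abs_add_le _ _).trans ?_
    have : (0 : ℝ) ≤ (1 / 4) ^ M := by positivity
    linarith

/-- Approximation of `cos (2 ^ j * θ)` by repeated doubling of the argument. -/
noncomputable def approxCos (M : ℕ) : ℕ → ℝ → ℝ
  | 0, θ => 1 - approxMul M θ θ / 2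
  | j + 1, θ => 2 * approxMul M (approxCos M j θ) (approxCos M j θ) - 1

theorem abs_approxCos_le (M : ℕ) {θ : ℝ} (hθ : |θ| ≤ 1) (j : ℕ) : |approxCos M j θ| ≤ 1 := by
  induction j with
  | zero =>
    have h := approxMul_self_mem hθ M
    rw [approxCos, abs_le]
    constructor <;> linarith [h.1, h.2]
  | succ j ih =>
    have h := approxMul_self_mem ih M
    rw [approxCos, abs_le]
    constructor <;> linarith [h.1, h.2]

theorem abs_approxCos_sub_le (M : ℕ) {θ : ℝ} (hθ : |θ| ≤ 1) (j : ℕ) :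
    |approxCos M j θ - Real.cos (2 ^ j * θ)| ≤ 4 ^ j * (|θ| ^ 4 + 2 * (1 / 4) ^ M) := by
  have hη : (0 : ℝ) ≤ (1 / 4) ^ M := by positivity
  -- The recursion `e ↦ 4 * e + 2 * η`, with `η = (1 / 4) ^ M`, closes only once `η` is subtracted
  -- from the bound: `4 * (A - η) + 2 * η ≤ 4 * A - η`.
  suffices h : |approxCos M j θ - Real.cos (2 ^ j * θ)| ≤
      4 ^ j * (|θ| ^ 4 + 2 * (1 / 4) ^ M) - (1 / 4) ^ M by linarith
  induction j with
  | zero =>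
    have h1 := Real.cos_bound hθ
    have h2 := abs_approxMul_sub_le (u := θ) (v := θ) (by linarith) M
    have h3 : 0 ≤ |θ| ^ 4 := by positivity
    rw [approxCos, pow_zero, pow_zero, one_mul, one_mul]
    rw [abs_le] at *
    constructor <;> nlinarith [h1.1, h1.2, h2.1, h2.2]
  | succ j ih =>
    have hc := abs_approxCos_le M hθ j
    have h2 := abs_approxMul_sub_le (u := approxCos M j θ) (v := approxCos M j θ) (by linarith) M
    rw [approxCos, pow_succ, mul_comm _ (2 : ℝ), mul_assoc, Real.cos_two_mul]
    set u := approxCos M j θ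
    set C := Real.cos (2 ^ j * θ)
    have hC : |C| ≤ 1 := Real.abs_cos_le_one _
    have h3 : |u * u - C ^ 2| ≤ 2 * |u - C| := by
      rw [show u * u - C ^ 2 = (u + C) * (u - C) by ring, abs_mul]
      exact mul_le_mul_of_nonneg_right ((abs_add_le _ _).trans (by linarith)) (abs_nonneg _)
    rw [show 2 * approxMul M u u - 1 - (2 * C ^ 2 - 1) =
      2 * (approxMul M u u - u * u) + 2 * (u * u - C ^ 2) by ring]
    refine (abs_add_le _ _).trans ?_
    rw [abs_mul, abs_mul, abs_two, pow_succ (4 : ℝ) j]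
    linarith

/-- Approximation of `cos (2 ^ m * μ * ∑ n, c n * z ^ n) * (∑ n, d n * z ^ n) / 2`. -/
noncomputable def approxTexture (M m N : ℕ) (μ : ℝ) (c d : ℕ → ℝ) (z : ℝ) : ℝ :=
  approxMul M (approxCos M m (μ * approxHorner M N c z) / 2) (approxHorner M N d z)

/-- The number of layers spent on `approxTexture`. -/
def textureDepth (M m N : ℕ) : ℕ := 2 * (N * (M + 5)) + (m + 1) * (M + 5) + M + 8

/-! ### Networks for polynomials, cosines and local textures -/

namespace Computes

variable {X : Set ℝ} {L : ℕ} {F : List (ℝ → ℝ)}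

theorem approxHorner {z : ℝ → ℝ} {M : ℕ} (hM : 2 ≤ M) (hz : ∀ x ∈ X, z x ∈ Set.Icc (0 : ℝ) (1 / 4))
    (hF : ∀ g ∈ F, ∀ x ∈ X, 0 ≤ g x) (hlen : F.length ≤ 25) (N : ℕ) {c : ℕ → ℝ}
    (hc : ∀ n, |c n| ≤ 1) (h : Computes X L (z :: F)) :
    Computes X (L + 1 + N * (M + 5)) ([fun x => approxHorner M N c (z x),
      fun x => -approxHorner M N c (z x)] ++ z :: F) := by
  have hzF : ∀ g ∈ z :: F, ∀ x ∈ X, 0 ≤ g x := by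
    simp only [List.mem_cons, forall_eq_or_imp]
    exact ⟨fun x hx => (hz x hx).1, hF⟩
  have hlen' : (z :: F).length ≤ 26 := by simp; omega
  induction N generalizing c with
  | zero =>
    rw [zero_mul, add_zero]
    refine frame_step (P := []) h (by simp) (by simp; omega) hzF ?_
    simp only [List.mem_cons, List.not_mem_nil, or_false, forall_eq_or_imp, forall_eq]
    exact ⟨⟨[], 0, by simp, by simp, fun x _ => by simp [_root_.approxHorner]⟩,
      ⟨[], 0, by simp, by simp, fun x _ => by simp [_root_.approxHorner]⟩⟩
  | succ N ih =>
    have h0 := ih fun n => hc (n + 1)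
    set p : ℝ → ℝ := fun x => _root_.approxHorner M N (fun n => c (n + 1)) (z x) with hp
    have s1 : Computes X (L + 1 + N * (M + 5) + 1)
        ([z, fun x => -z x, p, fun x => -p x] ++ z :: F) := by
      refine h0.frame_step (by simp) (by simp; omega) hzF ?_
      simp only [List.mem_cons, List.not_mem_nil, or_false, forall_eq_or_imp, forall_eq]
      refine ⟨⟨[0, 0, 1], 0, by simp, by simp, fun x hx => ?_⟩,
        ⟨[0, 0, -1], 0, by simp, by simp, fun x hx => ?_⟩,
        ⟨[1, -1], 0, by simp, by simp, fun x hx => ?_⟩,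
        ⟨[-1, 1], 0, by simp, by simp, fun x hx => ?_⟩⟩
      · simp [relu_of_nonneg (hz x hx).1]
      · simp [relu_of_nonneg (hz x hx).1]
      · have := relu_sub_relu_neg (p x)
        simp only [List.cons_append, reluCombination_cons, reluCombination_nil]
        linarith
      · have := relu_sub_relu_neg (p x)
        simp only [List.cons_append, reluCombination_cons, reluCombination_nil]
        linarith
    have s2 := s1.approxMul (fun x hx => by
      have h1 := abs_approxHorner_le hM (hz x hx) N fun n => hc (n + 1)
      rw [abs_of_nonneg (hz x hx).1]
      linarith [(hz x hx).2]) hzF hlen' M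
    have s3 := s2.frame_step (Q := [fun x => _root_.approxHorner M (N + 1) c (z x),
        fun x => -_root_.approxHorner M (N + 1) c (z x)]) (by simp) (by simp; omega) hzF (by
      simp only [List.mem_cons, List.not_mem_nil, or_false, forall_eq_or_imp, forall_eq]
      refine ⟨⟨[1, -1], c 0, by simp, hc 0, fun x hx => ?_⟩,
        ⟨[-1, 1], -c 0, by simp, by simpa using hc 0, fun x hx => ?_⟩⟩
      all_goals
        have := relu_sub_relu_neg (_root_.approxMul M (z x) (p x))
        simp only [List.cons_append, reluCombination_cons, reluCombination_nil,
          _root_.approxHorner]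
        linarith)
    exact s3.mono (by rw [Nat.succ_mul]; omega)

theorem approxCos {θ : ℝ → ℝ} (hθ : ∀ x ∈ X, |θ x| ≤ 1) (hF : ∀ g ∈ F, ∀ x ∈ X, 0 ≤ g x)
    (hlen : F.length ≤ 26) (M m : ℕ) (h : Computes X L ([θ, fun x => -θ x] ++ F)) :
    Computes X (L + (m + 1) * (M + 5)) ([fun x => approxCos M m (θ x),
      fun x => -approxCos M m (θ x)] ++ F) := by
  have hsq : ∀ {L : ℕ} {u : ℝ → ℝ}, (∀ x ∈ X, |u x| ≤ 1) →
      Computes X L ([u, fun x => -u x] ++ F) →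
      Computes X (L + 1 + (M + 3)) ([fun x => _root_.approxMul M (u x) (u x),
        fun x => -_root_.approxMul M (u x) (u x), fun x => _root_.approxMul M (u x) (u x),
        fun x => -_root_.approxMul M (u x) (u x)] ++ F) := by
    intro L u hu h
    refine approxMul (fun x hx => by linarith [hu x hx]) hF hlen M
      (h.frame_step (by simp) (by simp; omega) hF ?_)
    simp only [List.mem_cons, List.not_mem_nil, or_false, forall_eq_or_imp, forall_eq]
    refine ⟨⟨[1, -1], 0, by simp, by simp, fun x hx => ?_⟩,
      ⟨[-1, 1], 0, by simp, by simp, fun x hx => ?_⟩,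
      ⟨[1, -1], 0, by simp, by simp, fun x hx => ?_⟩,
      ⟨[-1, 1], 0, by simp, by simp, fun x hx => ?_⟩⟩
    all_goals
      have := relu_sub_relu_neg (u x)
      simp only [List.cons_append, reluCombination_cons, reluCombination_nil]
      linarith
  have h2 : (2⁻¹ : ℝ) ≤ 1 := by norm_num
  induction m with
  | zero =>
    refine ((hsq hθ h).frame_step (Q := [fun x => _root_.approxCos M 0 (θ x),
      fun x => -_root_.approxCos M 0 (θ x)]) (by simp) (by simp; omega) hF ?_).mono (by omega)
    simp only [List.mem_cons, List.not_mem_nil, or_false, forall_eq_or_imp, forall_eq]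
    refine ⟨⟨[-2⁻¹, 2⁻¹], 1, by simp [h2], by simp, fun x hx => ?_⟩,
      ⟨[2⁻¹, -2⁻¹], -1, by simp [h2], by simp, fun x hx => ?_⟩⟩
    all_goals
      have := relu_sub_relu_neg (_root_.approxMul M (θ x) (θ x))
      simp only [List.cons_append, reluCombination_cons, reluCombination_nil, _root_.approxCos]
      linarith
  | succ m ih =>
    have hc := fun x hx => abs_approxCos_le M (hθ x hx) m
    refine ((hsq hc ih).frame_step (Q := [fun x => _root_.approxCos M (m + 1) (θ x),
      fun x => -_root_.approxCos M (m + 1) (θ x)]) (by simp) (by simp; omega) hF ?_).mono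
        (by rw [Nat.succ_mul (m + 1)]; omega)
    simp only [List.mem_cons, List.not_mem_nil, or_false, forall_eq_or_imp, forall_eq]
    -- The two copies of the square supply the factor `2` in `2 cos² - 1`.
    refine ⟨⟨[1, -1, 1, -1], -1, by simp, by simp, fun x hx => ?_⟩,
      ⟨[-1, 1, -1, 1], 1, by simp, by simp, fun x hx => ?_⟩⟩
    all_goals
      have := relu_sub_relu_neg (_root_.approxMul M (_root_.approxCos M m (θ x))
        (_root_.approxCos M m (θ x)))
      simp only [List.cons_append, reluCombination_cons, reluCombination_nil, _root_.approxCos]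
      linarith

theorem approxTexture {z : ℝ → ℝ} {M : ℕ} (hM : 2 ≤ M)
    (hz : ∀ x ∈ X, z x ∈ Set.Icc (0 : ℝ) (1 / 4))
    (hF : ∀ g ∈ F, ∀ x ∈ X, 0 ≤ g x) (hlen : F.length ≤ 23) (m N : ℕ) {c d : ℕ → ℝ}
    (hc : ∀ n, |c n| ≤ 1) (hd : ∀ n, |d n| ≤ 1) {μ : ℝ} (hμ : |μ| ≤ 2 / 3)
    (h : Computes X L (z :: F)) :
    Computes X (L + textureDepth M m N) ([fun x => approxTexture M m N μ c d (z x),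
      fun x => -approxTexture M m N μ c d (z x), fun x => approxTexture M m N μ c d (z x),
      fun x => -approxTexture M m N μ c d (z x)] ++ z :: F) := by
  have h2 : (2⁻¹ : ℝ) ≤ 1 := by norm_num
  have hμ1 : |μ| ≤ 1 := hμ.trans (by norm_num)
  set p : ℝ → ℝ := fun x => _root_.approxHorner M N d (z x) with hp
  set q : ℝ → ℝ := fun x => _root_.approxHorner M N c (z x) with hq
  set θ : ℝ → ℝ := fun x => μ * q x with hθ
  set u : ℝ → ℝ := fun x => _root_.approxCos M m (θ x) with hu
  have hpb : ∀ x ∈ X, |p x| ≤ 3 / 2 := fun x hx => abs_approxHorner_le hM (hz x hx) N hd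
  have hθb : ∀ x ∈ X, |θ x| ≤ 1 := fun x hx => by
    rw [hθ, abs_mul]
    refine (mul_le_mul hμ (abs_approxHorner_le hM (hz x hx) N hc) (abs_nonneg _)
      (by norm_num)).trans (by norm_num)
  have hub : ∀ x ∈ X, |u x| ≤ 1 := fun x hx => abs_approxCos_le M (hθb x hx) m
  have s1 := h.approxHorner hM hz hF (by omega) N hd
  -- While the cosine is computed, `p` is stored as its positive and negative parts, because only
  -- non-negative functions pass through the rectifier unchanged.
  set G : List (ℝ → ℝ) := (fun x => relu (p x)) :: (fun x => relu (-p x)) :: F with hG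
  have hGnonneg : ∀ g ∈ G, ∀ x ∈ X, 0 ≤ g x := by
    simp only [hG, List.mem_cons, forall_eq_or_imp]
    exact ⟨fun x _ => relu_nonneg _, fun x _ => relu_nonneg _, hF⟩
  have hzG : ∀ g ∈ z :: G, ∀ x ∈ X, 0 ≤ g x := by
    simp only [List.mem_cons, forall_eq_or_imp]
    exact ⟨fun x hx => (hz x hx).1, hGnonneg⟩
  have hzF : ∀ g ∈ z :: F, ∀ x ∈ X, 0 ≤ g x := by
    simp only [List.mem_cons, forall_eq_or_imp]
    exact ⟨fun x hx => (hz x hx).1, hF⟩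
  have s2 : Computes X (L + 1 + N * (M + 5) + 1) (z :: G) := by
    refine frame_step (Q := [z, fun x => relu (p x), fun x => relu (-p x)]) (F := F)
      (P := [p, fun x => -p x, z]) s1 (by simp) (by simp; omega) hF ?_
    simp only [List.mem_cons, List.not_mem_nil, or_false, forall_eq_or_imp, forall_eq]
    exact ⟨⟨[0, 0, 1], 0, by simp, by simp, fun x hx => by simp [relu_of_nonneg (hz x hx).1]⟩,
      ⟨[1], 0, by simp, by simp, fun x hx => by simp⟩,
      ⟨[0, 1], 0, by simp, by simp, fun x hx => by simp⟩⟩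
  have s3 := s2.approxHorner hM hz hGnonneg (by simp [hG]; omega) N hc
  have s4 : Computes X (L + 1 + N * (M + 5) + 1 + 1 + N * (M + 5) + 1)
      ([θ, fun x => -θ x] ++ z :: G) := by
    refine s3.frame_step (by simp) (by simp [hG]; omega) hzG ?_
    simp only [List.mem_cons, List.not_mem_nil, or_false, forall_eq_or_imp, forall_eq]
    refine ⟨⟨[μ, -μ], 0, by simp [hμ1], by simp, fun x hx => ?_⟩,
      ⟨[-μ, μ], 0, by simp [hμ1], by simp, fun x hx => ?_⟩⟩
    all_goals
      simp only [List.cons_append, reluCombination_cons, reluCombination_nil, ← hq, hθ]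
      rw [← sub_eq_zero]
      nth_rw 1 [← relu_sub_relu_neg (q x)]
      ring
  have s5 := s4.approxCos hθb hzG (by simp [hG]; omega) M m
  have s6 : Computes X (L + 1 + N * (M + 5) + 1 + 1 + N * (M + 5) + 1 + (m + 1) * (M + 5) + 1)
      ([fun x => u x / 2, fun x => -(u x / 2), p, fun x => -p x] ++ z :: F) := by
    refine frame_step (Q := [fun x => u x / 2, fun x => -(u x / 2), p, fun x => -p x, z])
      (P := [u, fun x => -u x, z, fun x => relu (p x), fun x => relu (-p x)]) (F := F) s5
      (by simp) (by simp; omega) hF ?_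
    simp only [List.mem_cons, List.not_mem_nil, or_false, forall_eq_or_imp, forall_eq]
    refine ⟨⟨[2⁻¹, -2⁻¹], 0, by simp [h2], by simp, fun x hx => ?_⟩,
      ⟨[-2⁻¹, 2⁻¹], 0, by simp [h2], by simp, fun x hx => ?_⟩,
      ⟨[0, 0, 0, 1, -1], 0, by simp, by simp, fun x hx => ?_⟩,
      ⟨[0, 0, 0, -1, 1], 0, by simp, by simp, fun x hx => ?_⟩,
      ⟨[0, 0, 1], 0, by simp, by simp, fun x hx => by simp [relu_of_nonneg (hz x hx).1]⟩⟩
    all_goals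
      have h1 := relu_sub_relu_neg (u x)
      have h2 := relu_sub_relu_neg (p x)
      simp only [List.cons_append, reluCombination_cons, reluCombination_nil, relu_relu]
      linarith
  -- Halving `u` makes the product admissible: `1 / 2 + 3 / 2 ≤ 2`.
  have s7 := s6.approxMul (fun x hx => by
    rw [abs_div, abs_two]; linarith [hub x hx, hpb x hx]) hzF (by simp; omega) M
  exact s7.mono (by rw [textureDepth]; omega)

end Computes

/-! ### Local approximation of a texture -/

theorem abs_approxTexture_sub_le {M m N : ℕ} (hM : 2 ≤ M) {c d : ℕ → ℝ}
    (hc : ∀ n, |c n| ≤ 1) (hd : ∀ n, |d n| ≤ 1) {a : ℝ} (ha : 0 ≤ a) (hm : 3 * a ≤ 2 * 2 ^ m)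
    {z : ℝ} (hz : z ∈ Set.Icc (0 : ℝ) (1 / 4)) {y w δ : ℝ} (hw : |w| ≤ 1)
    (hy : |y - ∑ n ∈ Finset.range N, c n * z ^ n| ≤ δ)
    (hwd : |w - ∑ n ∈ Finset.range N, d n * z ^ n| ≤ δ) :
    |approxTexture M m N (a / 2 ^ m) c d z - Real.cos (a * y) * w / 2| ≤
      (1 / 4) ^ M + 4 ^ m * ((3 / 2 * (a / 2 ^ m)) ^ 4 + 2 * (1 / 4) ^ M) +
        (a + 1) * (2 * (1 / 4) ^ M + δ) := by
  have hq := abs_approxHorner_le hM hz N hc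
  have hp := abs_approxHorner_le hM hz N hd
  have hq' := abs_approxHorner_sub_le hM hz N hc
  have hp' := abs_approxHorner_sub_le hM hz N hd
  rw [approxTexture]
  set q := approxHorner M N c z
  set p := approxHorner M N d z
  have h2m : (0 : ℝ) < 2 ^ m := by positivity
  have hqy : |q - y| ≤ 2 * (1 / 4) ^ M + δ := by
    rw [abs_le] at *; constructor <;> linarith [hq'.1, hq'.2, hy.1, hy.2]
  have hpw : |p - w| ≤ 2 * (1 / 4) ^ M + δ := by
    rw [abs_le] at *; constructor <;> linarith [hp'.1, hp'.2, hwd.1, hwd.2]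
  have hμ : 0 ≤ a / 2 ^ m := by positivity
  have hθ' : |a / 2 ^ m * q| ≤ 3 / 2 * (a / 2 ^ m) := by
    rw [abs_mul, abs_of_nonneg hμ, mul_comm]; exact mul_le_mul_of_nonneg_right hq hμ
  have hθ : |a / 2 ^ m * q| ≤ 1 := hθ'.trans (by
    rw [← mul_div_assoc, div_le_one h2m]; linarith)
  have hu := abs_approxCos_sub_le M hθ m
  have hu1 := abs_approxCos_le M hθ m
  rw [show 2 ^ m * (a / 2 ^ m * q) = a * q by field_simp] at hu
  set u := approxCos M m (a / 2 ^ m * q)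
  have hE : |u - Real.cos (a * q)| ≤ 4 ^ m * ((3 / 2 * (a / 2 ^ m)) ^ 4 + 2 * (1 / 4) ^ M) :=
    hu.trans (by gcongr)
  have hcos : |Real.cos (a * q) - Real.cos (a * y)| ≤ a * (2 * (1 / 4) ^ M + δ) := by
    refine (Real.abs_cos_sub_cos_le _ _).trans ?_
    rw [← mul_sub, abs_mul, abs_of_nonneg ha]
    exact mul_le_mul_of_nonneg_left hqy ha
  have hmul := abs_approxMul_sub_le (u := u / 2) (v := p) (by
    rw [abs_div, abs_two]; linarith) M
  rw [show approxMul M (u / 2) p - Real.cos (a * y) * w / 2 =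
    (approxMul M (u / 2) p - u / 2 * p) + ((u - Real.cos (a * q)) * w / 2 +
      (Real.cos (a * q) - Real.cos (a * y)) * w / 2 + u * (p - w) / 2) by ring]
  refine (abs_add_le _ _).trans ?_
  have t1 : |(u - Real.cos (a * q)) * w / 2| ≤ |u - Real.cos (a * q)| := by
    rw [abs_div, abs_mul, abs_two]; nlinarith [abs_nonneg (u - Real.cos (a * q)), abs_nonneg w]
  have t2 : |(Real.cos (a * q) - Real.cos (a * y)) * w / 2| ≤
      |Real.cos (a * q) - Real.cos (a * y)| := by
    rw [abs_div, abs_mul, abs_two]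
    nlinarith [abs_nonneg (Real.cos (a * q) - Real.cos (a * y)), abs_nonneg w]
  have t3 : |u * (p - w) / 2| ≤ |p - w| := by
    rw [abs_div, abs_mul, abs_two]; nlinarith [abs_nonneg (p - w), abs_nonneg u]
  have := abs_add_three ((u - Real.cos (a * q)) * w / 2)
    ((Real.cos (a * q) - Real.cos (a * y)) * w / 2) (u * (p - w) / 2)
  linarith

/-- Local power series approximation of the functions in `smoothClass`. -/
theorem exists_taylor_coeff {D : ℝ} (hD : 0 < D) {f : ℝ → ℝ} (hf : f ∈ smoothClass (-D) D) {t : ℝ}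
    (ht : t ∈ Set.Icc (-D) D) :
    ∃ c : ℕ → ℝ, (∀ n, |c n| ≤ 1) ∧ ∀ N : ℕ, ∀ z ∈ Set.Icc (0 : ℝ) (1 / 4), t + z ≤ D →
      |f (t + z) - ∑ n ∈ Finset.range (N + 1), c n * z ^ n| ≤ (1 / 2) ^ N := by
  obtain ⟨hsm, hb⟩ := hf
  refine ⟨fun n => iteratedDerivWithin n f (Set.Icc (-D) D) t / n.factorial, fun n => ?_,
    fun N z hz htz => ?_⟩
  · rw [abs_div, Nat.abs_cast, div_le_one (by positivity)]
    exact hb n t ht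
  -- For `z = 0` the interval `[t, t + z]` is a point, and derivatives within it are not unique.
  · rcases hz.1.eq_or_lt with rfl | hz0
    · simp [Finset.sum_range_succ']
    have hsub : Set.Icc t (t + z) ⊆ Set.Icc (-D) D := Set.Icc_subset_Icc ht.1 htz
    have hU : UniqueDiffOn ℝ (Set.Icc t (t + z)) := uniqueDiffOn_Icc (by linarith)
    have hU' : UniqueDiffOn ℝ (Set.Icc (-D) D) := uniqueDiffOn_Icc (by linarith)
    have hder : ∀ n : ℕ, ∀ y ∈ Set.Icc t (t + z), iteratedDerivWithin n f (Set.Icc t (t + z)) y =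
        iteratedDerivWithin n f (Set.Icc (-D) D) y := fun n y hy => by
      rw [iteratedDerivWithin, iteratedDerivWithin, iteratedFDerivWithin_subset hsub hU hU'
        (hsm.of_le (by exact_mod_cast le_top)) hy]
    have hmem : t + z ∈ Set.Icc t (t + z) := ⟨by linarith, le_rfl⟩
    have h := taylor_mean_remainder_bound (f := f) (a := t) (b := t + z) (x := t + z) (n := N)
      (C := (N + 1).factorial) (by linarith)
      ((hsm.mono hsub).of_le (by exact_mod_cast le_top)) hmem
      (fun y hy => by rw [hder _ y hy]; exact hb _ y (hsub hy))
    rw [taylor_within_apply, Real.norm_eq_abs] at h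
    have hsum : ∑ k ∈ Finset.range (N + 1), ((k.factorial : ℝ)⁻¹ * (t + z - t) ^ k) •
        iteratedDerivWithin k f (Set.Icc t (t + z)) t = ∑ n ∈ Finset.range (N + 1),
        iteratedDerivWithin n f (Set.Icc (-D) D) t / n.factorial * z ^ n := by
      refine Finset.sum_congr rfl fun k _ => ?_
      rw [hder k t ⟨le_rfl, by linarith⟩, add_sub_cancel_left, smul_eq_mul]
      ring
    rw [hsum] at h
    refine h.trans ?_
    -- The remainder bound divides by `N !`, not `(N + 1)!`; the surplus factor `N + 1` is absorbed
    -- by `2 ^ (N + 1)`.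
    rw [Nat.factorial_succ, add_sub_cancel_left, Nat.cast_mul, mul_right_comm,
      mul_div_cancel_right₀ _ (by positivity)]
    have h1 : z ^ (N + 1) ≤ (1 / 4) ^ (N + 1) := pow_le_pow_left₀ hz0.le hz.2 _
    have h2 : ((N + 1 : ℕ) : ℝ) ≤ 2 ^ (N + 1) := by exact_mod_cast Nat.lt_two_pow_self.le
    calc ((N + 1 : ℕ) : ℝ) * z ^ (N + 1) ≤ 2 ^ (N + 1) * (1 / 4) ^ (N + 1) := by gcongr
      _ = (1 / 2) ^ (N + 1) := by rw [← mul_pow]; norm_num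
      _ ≤ (1 / 2) ^ N := pow_le_pow_of_le_one (by norm_num) (by norm_num) (Nat.le_succ N)

theorem abs_le_one_of_mem_smoothClass {a b : ℝ} {f : ℝ → ℝ} (hf : f ∈ smoothClass a b) {x : ℝ}
    (hx : x ∈ Set.Icc a b) : |f x| ≤ 1 := by
  simpa using hf.2 0 x hx

theorem abs_le_one_of_mem_oscillatoryTextures {D a : ℝ} {f : ℝ → ℝ}
    (hf : f ∈ oscillatoryTextures D a) {x : ℝ} (hx : x ∈ Set.Icc (-D) D) : |f x| ≤ 1 := by
  obtain ⟨g, _, h, hh, hfx⟩ := hf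
  rw [hfx x hx, abs_mul]
  exact mul_le_one₀ (Real.abs_cos_le_one _) (abs_nonneg _) (abs_le_one_of_mem_smoothClass hh hx)

/-- A local approximation of an oscillatory texture on an interval of length `1 / 4`. -/
theorem exists_local_approx {D a ε : ℝ} (hD : 0 < D) (ha : 0 < a) (hε : ε < 1 / 2) {f : ℝ → ℝ}
    (hf : f ∈ oscillatoryTextures D a) {k : ℕ} (hk : 1 ≤ k) (hε' : 64 ≤ ε * 2 ^ k)
    (hak : 64 * a ≤ ε * 2 ^ k) {t : ℝ} (ht : t ∈ Set.Icc (-D) D) :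
    ∃ q : ℝ → ℝ, |q 0| ≤ 1 ∧
      (∀ z ∈ Set.Icc (0 : ℝ) (1 / 4), t + z ≤ D → |q z - f (t + z) / 2| ≤ ε / 16) ∧
      ∀ (X : Set ℝ) (L : ℕ) (F : List (ℝ → ℝ)) (z : ℝ → ℝ),
        (∀ x ∈ X, z x ∈ Set.Icc (0 : ℝ) (1 / 4)) → (∀ g ∈ F, ∀ x ∈ X, 0 ≤ g x) → F.length ≤ 23 →
        Computes X L (z :: F) →
        Computes X (L + textureDepth (6 * k) (3 * k) (6 * k + 1))
          ([fun x => q (z x), fun x => -q (z x), fun x => q (z x), fun x => -q (z x)] ++ z :: F) := by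
  have hf' := hf
  obtain ⟨g, hg, h, hh, hfx⟩ := hf'
  obtain ⟨c, hc, hcg⟩ := exists_taylor_coeff hD hg ht
  obtain ⟨d, hd, hdh⟩ := exists_taylor_coeff hD hh ht
  have hM : 2 ≤ 6 * k := by omega
  have hB0 : (0 : ℝ) < 2 ^ k := by positivity
  have hε0 : 0 < ε := pos_of_mul_pos_left (by linarith) hB0.le
  -- All errors are measured in powers of `B`: doubling costs `4 ^ m = B ^ 6`, products err by `B ^
  -- (-12)`, Taylor polynomials by `B ^ (-6)`, while `a ≤ B / 128` and `1 / B ≤ ε / 64`.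
  set B : ℝ := 2 ^ k with hB
  have hB128 : 128 ≤ B := by nlinarith
  have e1 : (2 : ℝ) ^ (3 * k) = B ^ 3 := by rw [hB, ← pow_mul, mul_comm]
  have e2 : (4 : ℝ) ^ (3 * k) = B ^ 6 := by
    rw [hB, ← pow_mul, show (4 : ℝ) = 2 ^ 2 by norm_num, ← pow_mul]; congr 1; ring
  have e3 : (1 / 4 : ℝ) ^ (6 * k) = 1 / B ^ 12 := by
    rw [hB, ← pow_mul, one_div_pow, show (4 : ℝ) = 2 ^ 2 by norm_num, ← pow_mul]
    congr 2; ring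
  have e4 : (1 / 2 : ℝ) ^ (6 * k) = 1 / B ^ 6 := by
    rw [hB, ← pow_mul, one_div_pow]; congr 2; ring
  have haB : a ≤ B / 128 := by nlinarith
  have hBpos : ∀ j, 0 < B ^ j := fun j => by positivity
  have hB1 : 1 ≤ B := by linarith
  have ham : 3 * a ≤ 2 * 2 ^ (3 * k) := by
    rw [e1]; have : B ^ 1 ≤ B ^ 3 := pow_le_pow_right₀ hB1 (by norm_num)
    rw [pow_one] at this
    linarith
  have hεB : 1 / B ≤ ε / 64 := by rw [div_le_div_iff₀ hB0 (by norm_num)]; linarith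
  have happrox : ∀ z ∈ Set.Icc (0 : ℝ) (1 / 4), t + z ≤ D →
      |approxTexture (6 * k) (3 * k) (6 * k + 1) (a / 2 ^ (3 * k)) c d z - f (t + z) / 2|
        ≤ ε / 16 := by
    intro z hz htz
    have hx : t + z ∈ Set.Icc (-D) D := ⟨by linarith [ht.1, hz.1], htz⟩
    rw [hfx _ hx]
    refine (abs_approxTexture_sub_le hM hc hd ha.le ham hz
      (abs_le_one_of_mem_smoothClass hh hx) (hcg (6 * k) z hz htz)
      (hdh (6 * k) z hz htz)).trans ?_
    rw [e1, e2, e3, e4]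
    have hle : ∀ j, 1 ≤ j → 1 / B ^ j ≤ ε / 64 := fun j hj => by
      refine le_trans ?_ hεB
      exact one_div_le_one_div_of_le hB0 (by simpa using pow_le_pow_right₀ hB1 hj)
    have i1 := hle 12 (by norm_num)
    have i2 : B ^ 6 * ((3 / 2 * (a / B ^ 3)) ^ 4 + 2 * (1 / B ^ 12)) ≤ 1 / B ^ 1 := by
      have : (3 / 2 * (a / B ^ 3)) ^ 4 ≤ (1 / 64 / B ^ 2) ^ 4 := by
        refine pow_le_pow_left₀ (by positivity) ?_ 4
        rw [← mul_div_assoc, div_le_div_iff₀ (hBpos 3) (hBpos 2)]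
        nlinarith [hBpos 2]
      calc _ ≤ B ^ 6 * ((1 / 64 / B ^ 2) ^ 4 + 2 * (1 / B ^ 12)) := by gcongr
        _ = 1 / 64 ^ 4 * (1 / B ^ 2) + 2 * (1 / B ^ 6) := by field_simp
        _ ≤ 1 / 64 ^ 4 * (1 / B ^ 1) + 1 / 64 * (1 / B ^ 1) := by
          have j1 : 1 / B ^ 2 ≤ 1 / B ^ 1 :=
            one_div_le_one_div_of_le (hBpos 1) (pow_le_pow_right₀ hB1 (by norm_num))
          have j2 : 1 / B ^ 6 ≤ 1 / B ^ 2 :=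
            one_div_le_one_div_of_le (hBpos 2) (pow_le_pow_right₀ hB1 (by norm_num))
          have j3 : 1 / B ^ 2 ≤ 1 / 128 * (1 / B ^ 1) := by
            rw [pow_two, pow_one, one_div_mul_one_div, div_le_div_iff₀ (by positivity)
              (by positivity)]
            nlinarith
          linarith
        _ ≤ 1 / B ^ 1 := by
          have := one_div_pos.2 (hBpos 1)
          linarith
    have i3 : (a + 1) * (2 * (1 / B ^ 12) + 1 / B ^ 6) ≤ 1 / B ^ 1 := by
      have j1 : 1 / B ^ 12 ≤ 1 / B ^ 6 :=
        one_div_le_one_div_of_le (hBpos 6) (pow_le_pow_right₀ hB1 (by norm_num))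
      have j2 : 1 / B ^ 6 ≤ 1 / B ^ 3 :=
        one_div_le_one_div_of_le (hBpos 3) (pow_le_pow_right₀ hB1 (by norm_num))
      calc _ ≤ B * (3 * (1 / B ^ 3)) := by
            have : 0 < 1 / B ^ 12 := one_div_pos.2 (hBpos 12)
            exact mul_le_mul (by linarith) (by linarith) (by positivity) hB0.le
        _ = 3 / B ^ 2 := by field_simp
        _ ≤ 1 / B ^ 1 := by
          rw [div_le_div_iff₀ (hBpos 2) (hBpos 1)]; nlinarith
    have i4 := hle 1 le_rfl
    linarith
  refine ⟨approxTexture (6 * k) (3 * k) (6 * k + 1) (a / 2 ^ (3 * k)) c d, ?_, happrox, ?_⟩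
  · have h0 := happrox 0 (by norm_num) (by simpa using ht.2)
    have h1 := abs_le_one_of_mem_oscillatoryTextures hf ht
    rw [add_zero] at h0
    rw [abs_le] at *
    constructor <;> linarith [h0.1, h0.2, h1.1, h1.2]
  · intro X L F z hz hF hlen hcomp
    refine hcomp.approxTexture hM hz hF hlen _ _ hc hd ?_
    rw [abs_of_pos (by positivity), div_le_div_iff₀ (by positivity) (by norm_num)]
    linarith

/-! ### Gluing the local approximations -/

namespace Computes

variable {X : Set ℝ} {L : ℕ}

/-- Cuts the next piece `z` of length `1 / 4` off the remaining length `y` and adds the increment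
of `q`, corrected by a linear term, to the accumulator `S`. -/
theorem accumulate {T : ℕ} {q y S : ℝ → ℝ} {β : ℝ} (hβ : |β| ≤ 1) (hq0 : |q 0| ≤ 1)
    (hq : ∀ (L : ℕ) (F : List (ℝ → ℝ)) (z : ℝ → ℝ),
      (∀ x ∈ X, z x ∈ Set.Icc (0 : ℝ) (1 / 4)) → (∀ g ∈ F, ∀ x ∈ X, 0 ≤ g x) → F.length ≤ 23 →
      Computes X L (z :: F) → Computes X (L + T)
        ([fun x => q (z x), fun x => -q (z x), fun x => q (z x), fun x => -q (z x)] ++ z :: F))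
    (hy : ∀ x ∈ X, 0 ≤ y x)
    (h : Computes X L [y, fun x => relu (S x), fun x => relu (-S x)]) :
    Computes X (L + (T + 4)) [fun x => relu (y x - 1 / 4),
      fun x => relu (S x + q (y x - relu (y x - 1 / 4)) - q 0 + β * (y x - relu (y x - 1 / 4))),
      fun x => relu (-(S x + q (y x - relu (y x - 1 / 4)) - q 0
        + β * (y x - relu (y x - 1 / 4))))] := by
  have h4 : (4⁻¹ : ℝ) ≤ 1 := by norm_num
  set z : ℝ → ℝ := fun x => y x - relu (y x - 1 / 4) with hz
  set y' : ℝ → ℝ := fun x => relu (y x - 1 / 4) with hy'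
  have hzm : ∀ x ∈ X, z x ∈ Set.Icc (0 : ℝ) (1 / 4) := fun x hx => by
    have := hy x hx
    simp only [hz]
    rcases le_total (y x) (1 / 4) with h | h
    · rw [relu_of_nonpos (by linarith)]; constructor <;> linarith
    · rw [relu_of_nonneg (by linarith)]; constructor <;> linarith
  set P : List (ℝ → ℝ) := [fun x => relu (S x), fun x => relu (-S x)] with hP
  have hPn : ∀ g ∈ P, ∀ x ∈ X, 0 ≤ g x := by
    simp only [hP, List.mem_cons, List.not_mem_nil, or_false, forall_eq_or_imp, forall_eq]
    exact ⟨fun x _ => relu_nonneg _, fun x _ => relu_nonneg _⟩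
  have s1 : Computes X (L + 1) ([y, fun x => y x - 1 / 4] ++ P) := by
    refine frame_step (P := [y]) h (by simp) (by simp [hP]) hPn ?_
    simp only [List.mem_cons, List.not_mem_nil, or_false, forall_eq_or_imp, forall_eq]
    exact ⟨⟨[1], 0, by simp, by simp, fun x hx => by simp [relu_of_nonneg (hy x hx)]⟩,
      ⟨[1], -4⁻¹, by simp, by simpa using h4, fun x hx => by
        simp [relu_of_nonneg (hy x hx), sub_eq_add_neg]⟩⟩
  have s2 : Computes X (L + 1 + 1) ([z, y'] ++ P) := by
    refine s1.frame_step (by simp) (by simp [hP]) hPn ?_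
    simp only [List.mem_cons, List.not_mem_nil, or_false, forall_eq_or_imp, forall_eq]
    exact ⟨⟨[1, -1], 0, by simp, by simp, fun x hx => by
        simp [hz, relu_of_nonneg (hy x hx), sub_eq_add_neg]⟩,
      ⟨[0, 1], 0, by simp, by simp, fun x hx => by simp [hy']⟩⟩
  have s3 := hq (L + 1 + 1) (y' :: P) z hzm (by
    simp only [List.mem_cons, forall_eq_or_imp]
    exact ⟨fun x _ => relu_nonneg _, hPn⟩) (by simp [hP]) s2
  have s4 : Computes X (L + 1 + 1 + T + 1) [y', fun x => S x + q (z x) - q 0 + β * z x,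
      fun x => -(S x + q (z x) - q 0 + β * z x)] := by
    refine s3.step (by simp) (by simp) ?_
    simp only [List.mem_cons, List.not_mem_nil, or_false, forall_eq_or_imp, forall_eq]
    refine ⟨⟨[0, 0, 0, 0, 0, 1], 0, by simp, by simp, fun x hx => by simp [hy']⟩,
      -- The constant `q 0` enters as a bias, hence the need for `|q 0| ≤ 1`.
      ⟨[1, -1, 0, 0, β, 0, 1, -1], -q 0, by simp [hβ], by simpa using hq0, fun x hx => ?_⟩,
      ⟨[-1, 1, 0, 0, -β, 0, -1, 1], q 0, by simp [hβ], hq0, fun x hx => ?_⟩⟩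
    all_goals
      have h1 := relu_sub_relu_neg (q (z x))
      have h2 := relu_sub_relu_neg (S x)
      simp only [hP, List.cons_append, List.nil_append, reluCombination_cons, reluCombination_nil,
        relu_relu, relu_of_nonneg (hzm x hx).1]
      linarith
  have s5 := s4.step (l' := [y', fun x => relu (S x + q (z x) - q 0 + β * z x),
      fun x => relu (-(S x + q (z x) - q 0 + β * z x))]) (by simp) (by simp) (by
    simp only [List.mem_cons, List.not_mem_nil, or_false, forall_eq_or_imp, forall_eq]
    exact ⟨⟨[1], 0, by simp, by simp, fun x hx => by simp [hy']⟩,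
      ⟨[0, 1], 0, by simp, by simp, fun x hx => by simp⟩,
      ⟨[0, 0, 1], 0, by simp, by simp, fun x hx => by simp⟩⟩)
  exact s5.mono (by omega)

/-- The shift by `D` may exceed the admissible bias, so it is spread over `⌈D⌉₊` layers, each adding
`D / ⌈D⌉₊ ≤ 1`. -/
theorem relu_add_natCast_mul {s : ℝ} (h0 : 0 ≤ s) (h1 : s ≤ 1) (j : ℕ) :
    Computes X (2 + j) [fun x => relu x + j * s, fun x => relu (-x)] := by
  induction j with
  | zero =>
    refine (id_neg (X := X)).step (by simp) (by simp) ?_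
    simp only [List.mem_cons, List.not_mem_nil, or_false, forall_eq_or_imp, forall_eq]
    exact ⟨⟨[1], 0, by simp, by simp, fun x hx => by simp⟩,
      ⟨[0, 1], 0, by simp, by simp, fun x hx => by simp⟩⟩
  | succ j ih =>
    refine ih.step (by simp) (by simp) ?_
    simp only [List.mem_cons, List.not_mem_nil, or_false, forall_eq_or_imp, forall_eq]
    refine ⟨⟨[1], s, by simp, by rwa [abs_of_nonneg h0], fun x hx => ?_⟩,
      ⟨[0, 1], 0, by simp, by simp, fun x hx => by simp⟩⟩
    have : 0 ≤ relu x + j * s := by have := relu_nonneg x; positivity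
    simp only [reluCombination_cons, reluCombination_nil, relu_of_nonneg this]
    push_cast
    ring

theorem initial {D : ℝ} (hD : 0 < D) {v : ℝ} (hv : |v| ≤ 1) :
    Computes (Set.Icc (-D) D) (⌈D⌉₊ + 3)
      [fun x => relu (x + D), fun _ => relu v, fun _ => relu (-v)] := by
  have hc : (0 : ℝ) < ⌈D⌉₊ := by exact_mod_cast Nat.ceil_pos.2 hD
  have h := relu_add_natCast_mul (X := Set.Icc (-D) D) (s := D / ⌈D⌉₊) (by positivity)
    ((div_le_one hc).2 (Nat.le_ceil D)) ⌈D⌉₊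
  rw [mul_div_cancel₀ _ hc.ne'] at h
  have hrelu : ∀ w : ℝ, |w| ≤ 1 → |relu w| ≤ 1 := fun w hw => by
    rw [abs_of_nonneg (relu_nonneg w)]
    exact max_le ((le_abs_self w).trans hw) zero_le_one
  refine (h.step (l' := [fun x => relu (x + D), fun _ => relu v, fun _ => relu (-v)])
    (by simp) (by simp) ?_).mono (by omega)
  simp only [List.mem_cons, List.not_mem_nil, or_false, forall_eq_or_imp, forall_eq]
  refine ⟨⟨[1, -1], 0, by simp, by simp, fun x hx => ?_⟩,
    ⟨[], relu v, by simp, hrelu v hv, fun x hx => by simp⟩,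
    ⟨[], relu (-v), by simp, hrelu _ (by simpa using hv), fun x hx => by simp⟩⟩
  have h1 := relu_sub_relu_neg x
  have h2 := relu_nonneg x
  simp only [reluCombination_cons, reluCombination_nil, relu_relu]
  rw [relu_of_nonneg (by linarith : 0 ≤ relu x + D),
    relu_of_nonneg (by linarith [hx.1] : 0 ≤ x + D)]
  linarith

/-- The function obtained from local approximations by successive corrected increments. -/
theorem exists_glued {D ε : ℝ} (hD : 0 < D) (hε0 : 0 < ε) (hε : ε < 1 / 2) {f : ℝ → ℝ} {T : ℕ}
    (hf : ∀ x ∈ Set.Icc (-D) D, |f x| ≤ 1)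
    (hloc : ∀ t ∈ Set.Icc (-D) D, ∃ q : ℝ → ℝ, |q 0| ≤ 1 ∧
      (∀ z ∈ Set.Icc (0 : ℝ) (1 / 4), t + z ≤ D → |q z - f (t + z) / 2| ≤ ε / 16) ∧
      ∀ (X : Set ℝ) (L : ℕ) (F : List (ℝ → ℝ)) (z : ℝ → ℝ),
        (∀ x ∈ X, z x ∈ Set.Icc (0 : ℝ) (1 / 4)) → (∀ g ∈ F, ∀ x ∈ X, 0 ≤ g x) → F.length ≤ 23 →
        Computes X L (z :: F) → Computes X (L + T)
          ([fun x => q (z x), fun x => -q (z x), fun x => q (z x), fun x => -q (z x)] ++ z :: F)) :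
    ∃ S : ℝ → ℝ, Computes (Set.Icc (-D) D) (⌈D⌉₊ + 5 + (8 * ⌈D⌉₊ + 1) * (T + 4))
      [fun x => S x + S x] ∧ ∀ x ∈ Set.Icc (-D) D, |S x - f x / 2| ≤ ε / 4 := by
  -- Invariant after `k` pieces: `S` is accurate to the left of the grid point `-D + k / 4`, and to
  -- its right it is frozen at the exact value of `f / 2` there. The frozen value is what prevents
  -- errors from accumulating.
  have key : ∀ k : ℕ, (k : ℝ) / 4 ≤ 2 * D → ∃ S : ℝ → ℝ,
      Computes (Set.Icc (-D) D) (⌈D⌉₊ + 3 + k * (T + 4))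
        [fun x => relu (x + D - k / 4), fun x => relu (S x), fun x => relu (-S x)] ∧
      (∀ x ∈ Set.Icc (-D) D, x + D ≤ k / 4 → |S x - f x / 2| ≤ ε / 4) ∧
      ∀ x ∈ Set.Icc (-D) D, k / 4 ≤ x + D → S x = f (-D + k / 4) / 2 := by
    intro k
    induction k with
    | zero =>
      intro _
      have hD' : -D ∈ Set.Icc (-D) D := ⟨le_rfl, by linarith⟩
      refine ⟨fun _ => f (-D) / 2, ?_, fun x hx hxD => ?_, fun x hx _ => by simp⟩
      · have := initial hD (v := f (-D) / 2) (by
          rw [abs_div, abs_two]; linarith [hf _ hD'])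
        simpa using this
      · have : x = -D := le_antisymm (by simp at hxD; linarith) hx.1
        rw [this, sub_self, abs_zero]; linarith
    | succ k ih =>
      intro hk
      push_cast at hk
      obtain ⟨S, hS, hS1, hS2⟩ := ih (by linarith)
      have hk0 : (0 : ℝ) ≤ k := Nat.cast_nonneg k
      obtain ⟨q, hq0, hq, hqc⟩ := hloc (-D + k / 4) ⟨by linarith, by linarith⟩
      set t : ℝ := -D + k / 4 with ht
      have a0 := hq 0 (by norm_num) (by linarith)
      have a1 := hq (1 / 4) (by norm_num) (by linarith)
      rw [add_zero] at a0
      -- The slope that makes the corrected increment over a full piece exact. Two errors `ε / 16`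
      -- over a length `1 / 4` give `|β| ≤ ε / 2`.
      set β : ℝ := 4 * ((f (t + 1 / 4) - f t) / 2 - (q (1 / 4) - q 0)) with hβ
      have hβb : |β| ≤ ε / 2 := by
        rw [abs_le] at *
        constructor <;> linarith [a0.1, a0.2, a1.1, a1.2]
      have hy' : ∀ x : ℝ, relu (relu (x + D - k / 4) - 1 / 4) = relu (x + D - (k + 1) / 4) := by
        intro x
        rcases le_total (x + D) (k / 4) with h | h
        · rw [relu_of_nonpos (by linarith : x + D - k / 4 ≤ 0), relu_of_nonpos (by norm_num),
            relu_of_nonpos (by linarith)]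
        · rw [relu_of_nonneg (by linarith : 0 ≤ x + D - k / 4)]
          congr 1; ring
      have hstep := hS.accumulate (hβb.trans (by linarith)) hq0 (hqc _) (fun x _ => relu_nonneg _)
      refine ⟨_, by
        simp only [hy'] at hstep
        rw [show ⌈D⌉₊ + 3 + (k + 1) * (T + 4) = ⌈D⌉₊ + 3 + k * (T + 4) + (T + 4) by ring]
        push_cast
        exact hstep, fun x hx hxk => ?_, fun x hx hxk => ?_⟩
      · push_cast at hxk
        rw [relu_of_nonpos (by linarith : x + D - (k + 1) / 4 ≤ 0), sub_zero]
        rcases le_total (x + D) (k / 4) with h | h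
        · rw [relu_of_nonpos (by linarith)]
          simpa using hS1 x hx h
        · rw [relu_of_nonneg (by linarith), hS2 x hx h]
          have hz : x + D - k / 4 ∈ Set.Icc (0 : ℝ) (1 / 4) := ⟨by linarith, by linarith⟩
          have a2 := hq _ hz (by linarith [hx.2])
          rw [show t + (x + D - k / 4) = x by rw [ht]; ring] at a2
          have a3 : |β * (x + D - k / 4)| ≤ ε / 2 * (1 / 4) := by
            rw [abs_mul, abs_of_nonneg hz.1]
            exact mul_le_mul hβb hz.2 hz.1 (by linarith)
          rw [abs_le] at *
          constructor <;> linarith [a0.1, a0.2, a2.1, a2.2, a3.1, a3.2]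
      · push_cast at hxk ⊢
        rw [relu_of_nonneg (by linarith : 0 ≤ x + D - (k + 1) / 4),
          relu_of_nonneg (by linarith : 0 ≤ x + D - k / 4), hS2 x hx (by linarith),
          show x + D - k / 4 - (x + D - (k + 1) / 4) = 1 / 4 by ring,
          show -D + (k + 1) / 4 = t + 1 / 4 by rw [ht]; ring, hβ]
        ring
  -- The number of full pieces in `[-D, D]`. The remaining one is too short to have a right grid
  -- point and needs no correction, since nothing follows it.
  set K := ⌊8 * D⌋₊ with hK
  have hK1 : (K : ℝ) ≤ 8 * D := Nat.floor_le (by linarith)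
  have hK2 : 8 * D < K + 1 := Nat.lt_floor_add_one _
  have hK3 : K ≤ 8 * ⌈D⌉₊ := by
    have : (K : ℝ) ≤ ((8 * ⌈D⌉₊ : ℕ) : ℝ) := by push_cast; linarith [Nat.le_ceil D]
    exact_mod_cast this
  obtain ⟨S, hS, hS1, hS2⟩ := key K (by linarith)
  have hk0 : (0 : ℝ) ≤ K := Nat.cast_nonneg K
  obtain ⟨q, hq0, hq, hqc⟩ := hloc (-D + K / 4) ⟨by linarith, by linarith⟩
  set t : ℝ := -D + K / 4 with ht
  have a0 := hq 0 (by norm_num) (by linarith)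
  rw [add_zero] at a0
  have h1 := hS.accumulate (β := 0) (by simp) hq0 (hqc _) (fun x _ => relu_nonneg _)
  simp only [zero_mul, add_zero] at h1
  set R : ℝ → ℝ := fun x => S x + q (relu (x + D - K / 4) -
    relu (relu (x + D - K / 4) - 1 / 4)) - q 0 with hR
  refine ⟨R, ?_, fun x hx => ?_⟩
  -- Both parts of `R` are duplicated, so that the output `R + R`, which approximates `f`, needs
  -- only weights `±1`.
  · have h2 := h1.step (l' := [fun x => relu (R x), fun x => relu (-R x), fun x => relu (R x),
        fun x => relu (-R x)]) (by simp) (by simp) (by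
      simp only [List.mem_cons, List.not_mem_nil, or_false, forall_eq_or_imp, forall_eq]
      exact ⟨⟨[0, 1], 0, by simp, by simp, fun x hx => by simp [hR]⟩,
        ⟨[0, 0, 1], 0, by simp, by simp, fun x hx => by simp [hR]⟩,
        ⟨[0, 1], 0, by simp, by simp, fun x hx => by simp [hR]⟩,
        ⟨[0, 0, 1], 0, by simp, by simp, fun x hx => by simp [hR]⟩⟩)
    have h3 := h2.step (l' := [fun x => R x + R x]) (by simp) (by simp) (by
      simp only [List.mem_cons, List.not_mem_nil, or_false, forall_eq]
      refine ⟨[1, -1, 1, -1], 0, by simp, by simp, fun x hx => ?_⟩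
      have := relu_sub_relu_neg (R x)
      simp only [reluCombination_cons, reluCombination_nil, relu_relu]
      linarith)
    refine h3.mono ?_
    have := Nat.mul_le_mul_right (T + 4) hK3
    rw [Nat.succ_mul (8 * ⌈D⌉₊)]
    omega
  · simp only [hR]
    rcases le_total (x + D) (K / 4) with h | h
    · rw [relu_of_nonpos (by linarith : x + D - K / 4 ≤ 0), relu_of_nonpos (by norm_num)]
      simpa using hS1 x hx h
    · have hz : x + D - K / 4 ∈ Set.Icc (0 : ℝ) (1 / 4) := ⟨by linarith, by linarith [hx.2]⟩
      have a2 := hq _ hz (by linarith [hx.2])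
      rw [show t + (x + D - K / 4) = x by rw [ht]; ring] at a2
      rw [relu_of_nonneg hz.1, relu_of_nonpos (by linarith [hz.2] : x + D - K / 4 - 1 / 4 ≤ 0),
        sub_zero, hS2 x hx h]
      rw [abs_le] at *
      constructor <;> linarith [a0.1, a0.2, a2.1, a2.2]

end Computes

/-! ### Depth count and conclusion -/

theorem textureDepth_le {k : ℕ} (hk : 1 ≤ k) :
    textureDepth (6 * k) (3 * k) (6 * k + 1) + 4 ≤ 216 * k ^ 2 := by
  have : k ≤ k ^ 2 := Nat.le_self_pow (by norm_num) k
  have h1 : 1 ≤ k ^ 2 := hk.trans this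
  have : textureDepth (6 * k) (3 * k) (6 * k + 1) + 4 = 90 * k ^ 2 + 99 * k + 27 := by
    rw [textureDepth]; ring
  omega

theorem mainTheorem9 :
    ∃ C : ℝ, 0 < C ∧
      ∀ D a : ℝ, 0 < D → 0 < a →
      ∀ f ∈ oscillatoryTextures D a,
      ∀ ε : ℝ, 0 < ε → ε < 1 / 2 →
        ∃ Γ : ReLUNetwork 1 1,
          Γ.Nondegenerate ∧
          (∀ x ∈ Set.Icc (-D) D, |f x - Γ.realize (fun _ => x) 0| ≤ ε) ∧
          (Γ.depth : ℝ) ≤ C * (⌈D⌉₊ : ℝ) *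
            ((Real.logb 2 ε⁻¹ + Real.logb 2 (⌈a⌉₊ : ℝ)) ^ 2
              + Real.logb 2 (⌈D⌉₊ : ℝ) + Real.logb 2 (⌈D⁻¹⌉₊ : ℝ)) ∧
          Γ.width ≤ 32 ∧
          Γ.weightMagnitude ≤ 1 := by
  -- The final count needs `6 + 9 * 216 * 64 = 124422`.
  refine ⟨130000, by norm_num, fun D a hD ha f hf ε hε0 hε => ?_⟩
  have hlog : ∀ {r : ℝ}, 0 < r → (1 : ℝ) ≤ ⌈r⌉₊ ∧ 0 ≤ Real.logb 2 (⌈r⌉₊ : ℝ) := fun {r} hr => by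
    have h1 : (1 : ℝ) ≤ ⌈r⌉₊ := by exact_mod_cast Nat.ceil_pos.2 hr
    exact ⟨h1, Real.logb_nonneg one_lt_two h1⟩
  obtain ⟨ha1, hla⟩ := hlog ha
  obtain ⟨hD1, hlD⟩ := hlog hD
  obtain ⟨-, hlD'⟩ := hlog (inv_pos.2 hD)
  have hlε : 1 ≤ Real.logb 2 ε⁻¹ := by
    rw [Real.le_logb_iff_rpow_le one_lt_two (inv_pos.2 hε0), Real.rpow_one,
      le_inv_comm₀ two_pos hε0]
    linarith
  set Λ : ℝ := Real.logb 2 ε⁻¹ + Real.logb 2 (⌈a⌉₊ : ℝ) with hΛ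
  have hΛ1 : 1 ≤ Λ := by linarith
  -- The summand `6` supplies the factor `64 = 2 ^ 6` required by `exists_local_approx`; since `1 ≤
  -- Λ`, still `k ≤ Λ + 7 ≤ 8 * Λ`.
  set k : ℕ := ⌈Λ⌉₊ + 6 with hk
  have hk8 : (k : ℝ) ≤ 8 * Λ := by
    have := Nat.ceil_lt_add_one (a := Λ) (by linarith)
    rw [hk]; push_cast; linarith
  have hpow : 64 * (⌈a⌉₊ : ℝ) ≤ ε * 2 ^ k := by
    have h1 : ε⁻¹ * ⌈a⌉₊ ≤ (2 : ℝ) ^ ⌈Λ⌉₊ := by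
      rw [← Real.rpow_natCast, ← Real.logb_le_iff_le_rpow one_lt_two (by positivity),
        Real.logb_mul (by positivity) (by positivity)]
      exact Nat.le_ceil _
    have h2 : (⌈a⌉₊ : ℝ) ≤ ε * 2 ^ ⌈Λ⌉₊ := by
      rwa [inv_mul_le_iff₀ hε0] at h1
    rw [hk, pow_add]
    linarith
  have hk1 : 1 ≤ k := by omega
  obtain ⟨S, ⟨Φ, hpos, hdepth, hwidth, hmag, hΦ⟩, hSf⟩ := Computes.exists_glued hD hε0 hε
    (fun x hx => abs_le_one_of_mem_oscillatoryTextures hf hx)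
    (fun t ht => exists_local_approx hD ha hε hf hk1 (by linarith)
      (by linarith [Nat.le_ceil a]) ht)
  have hK : IsCompact ((fun x : ℝ => fun _ : Fin 1 => x) '' Set.Icc (-D) D) :=
    isCompact_Icc.image (by fun_prop)
  obtain ⟨Γ, hnd, hΓd, hΓw, hΓm, hΓ⟩ := ReLUNetwork.exists_nondegenerate_near one_pos hpos hmag hK
    (half_pos hε0)
  refine ⟨Γ, hnd, fun x hx => ?_, ?_, hΓw.trans_le hwidth, hΓm⟩
  · have h1 := (dist_le_pi_dist _ _ 0).trans (hΓ _ ⟨x, hx, rfl⟩)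
    rw [hΦ x hx 0, Real.dist_eq] at h1
    change |S x + S x - _| ≤ _ at h1
    have h2 := hSf x hx
    rw [abs_le] at *
    constructor <;> linarith [h1.1, h1.2, h2.1, h2.2]
  · have hT := textureDepth_le hk1
    have h1 : Γ.depth ≤ ⌈D⌉₊ + 5 + (8 * ⌈D⌉₊ + 1) * (216 * k ^ 2) :=
      (hΓd.trans_le hdepth).trans (by gcongr)
    have h2 : (Γ.depth : ℝ) ≤ ⌈D⌉₊ + 5 + (8 * ⌈D⌉₊ + 1) * (216 * k ^ 2) := by exact_mod_cast h1
    have h3 : (k : ℝ) ^ 2 ≤ 64 * Λ ^ 2 := by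
      calc (k : ℝ) ^ 2 ≤ (8 * Λ) ^ 2 := by gcongr
        _ = 64 * Λ ^ 2 := by ring
    have hΛ2 : 1 ≤ Λ ^ 2 := one_le_pow₀ hΛ1
    have h4 : (⌈D⌉₊ : ℝ) * 1 ≤ ⌈D⌉₊ * Λ ^ 2 := by gcongr
    calc (Γ.depth : ℝ) ≤ ⌈D⌉₊ + 5 + (8 * ⌈D⌉₊ + 1) * (216 * k ^ 2) := h2
      _ ≤ ⌈D⌉₊ + 5 * ⌈D⌉₊ + (8 * ⌈D⌉₊ + ⌈D⌉₊) * (216 * (64 * Λ ^ 2)) := by gcongr; linarith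
      _ ≤ 130000 * ⌈D⌉₊ * Λ ^ 2 := by linarith
      -- The logarithms of `⌈D⌉₊` and `⌈D⁻¹⌉₊` are non-negative and only enlarge the bound.
      _ ≤ _ := by gcongr; linarith
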